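/- **Setting.** Let $\mathcal M=\prod_{j=1}^d[L_j,U_j]\subset\mathbb R^d$ be a box, $0<m\le M$, and let $\mu$ be a probability measure on $\mathbb R^d$ with a Lebesgue density $f$ that vanishes outside $\mathcal M$ and satisfies $m\le f\le M$ on $\mathcal M$. Let $s:\{1,2,\dots\}\to\{1,\dots,d\}$ be a splitting schedule. *Hilbert path of $t$.* For $t\in[0,1]$ let $\alpha_1,\alpha_2,\dots$ be the base-$2^d$ digits of $t$ (terminating expansion if there are two; $1=0.111\ldots$ in base two). The $d$ splits with numbers $(r-1)d+1,\dots,rd$ form macro-level $r$. At each macro-level there is an orientation, i.e. a permutation of the axes (logical to geometric) and a set of flipped geometric axes; it is trivial at $r=1$. Split $l=(r-1)d+i$ cuts the geometric coordinate $j_l(t)$ that corresponds to the logical coordinate $s(l)$ in the orientation of macro-level $r$; the path then enters the upper child if the $i$-th most significant bit of the Gray code of $\alpha_r$ is $1$ and the lower child if it is $0$, with the two exchanged if $j_l(t)$ is flipped. The orientation of macro-level $r+1$ is obtained from that of macro-level $r$ and from $\alpha_r$ by the standard update rule of the $d$-dimensional Hilbert curve (for $d=2$: the quadrants are visited in the order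 LL, UL, UR, LR, the orientation is reflected across the main diagonal in LL and across the anti-diagonal in LR, and kept in UL and UR). *Balance.* For a constant $c_s>0$ there is a $C$ such that $\#\{l\le L: j_l(t)=j\}\ge c_sL/d-C$ for all $j\in\{1,\dots,d\}$ and all $L$. (For the cyclic schedule $s(l)=1+((l-1)\bmod d)$ this holds with $c_s=1$.) *Population map.* Put $\mathcal B_0(t)=\mathcal M$. For $l\ge1$ and $j=j_l(t)$ let $q_l(t)=\inf\{x:\mu(\{u\in\mathcal B_{l-1}(t):u_j\le x\})\ge\frac12\mu(\mathcal B_{l-1}(t))\}$, cut $\mathcal B_{l-1}(t)$ at $u_j=q_l(t)$, and let $\mathcal B_l(t)$ be the child that the path enters. Let $\mathbf H_{\mu,L}(t)\in\mathbb R^d$ be the vector whose $j$-th entry is the most recent cut $q_l(t)$, $l\le L$, with $j_l(t)=j$ ($0$ if there is none), and $\mathbf Q_\mu(t)=\lim_{L\to\infty}\mathbf H_{\mu,L}(t)$. *Estimator.* Let $\mathbf U_1,\mathbf U_2,\dots$ be i.i.d. with law $\mu$. From $\mathbf U_1,\dots,\mathbf U_n$ build the binary tree whose root holds all indices $1,\dots,n$.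 A node with index set $I$ at depth $l-1$ on the path of $t$ is split at the empirical median $\hat q=\inf\{x:\#\{i\in I:(\mathbf U_i)_j\le x\}\ge\#I/2\}$ of the coordinate $j=j_l(t)$ into $\{i\in I:(\mathbf U_i)_j\le\hat q\}$ (lower child) and the rest (upper child); the cut is stored, and no further splits are made if one of the two is empty. $\widehat{\mathbf Q}_{\mu,L}(t)$ is the vector of the most recent cuts along the path of $t$ in the tree of depth $L$, one entry for each coordinate ($0$ if there is none). **Theorem (pointwise convergence).** There is a constant $\gamma_0>0$, depending only on $d$, $\mathcal M$, $m$ and $M$, such that the following holds for all $\mu$, $s$, $c_s$ and $t\in[0,1]$ as above. The limit $\mathbf Q_\mu(t)$ exists. If $L=L_n$ satisfies $a\log n\le L_n\le b\log n$ for all large $n$, with constants $a,b>0$, then, as $n\to\infty$, $$\big\|\widehat{\mathbf Q}_{\mu,L_n}(t)-\mathbf Q_\mu(t)\big\|_2=O_p\big(n^{-c_s/(2d\gamma)}\big),\qquad \gamma=\max\Big\{\gamma_0,\ \frac1{2a\log(1/\rho)}\Big\},\quad \rho=1-\frac m{2M}.$$ In particular, for $L_n\ge\frac{\log n}{2\gamma_0\log(1/\rho)}$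 the constant $\gamma=\gamma_0$ depends only on the density bounds and the support geometry. -/

import Mathlib

open MeasureTheory ProbabilityTheory Filter Topology

/-! ### Boxes -/

/-- An axis-aligned box, given by its lower and upper corners. -/
structure Box (d : ℕ) where
  lo : Fin d → ℝ
  hi : Fin d → ℝ

/-- The closed box `∏ j, [lo j, hi j]` as a set of points. -/
def Box.toSet {d : ℕ} (B : Box d) : Set (EuclideanSpace ℝ (Fin d)) :=
  {u | ∀ j, B.lo j ≤ u j ∧ u j ≤ B.hi j}

/-- Cut the box at the value `q` of coordinate `j`; `upper = false` keeps the lower child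
and `upper = true` keeps the upper child. -/
def Box.cut {d : ℕ} (B : Box d) (j : Fin d) (q : ℝ) (upper : Bool) : Box d :=
  if upper then ⟨Function.update B.lo j q, B.hi⟩ else ⟨B.lo, Function.update B.hi j q⟩

/-- `μ` has a Lebesgue density which vanishes outside the box and takes values in `[m, M]` on
the whole box. -/
def HasDensityBounds {d : ℕ} (μ : Measure (EuclideanSpace ℝ (Fin d))) (B : Box d) (m M : ℝ) :
    Prop :=
  ∃ f : EuclideanSpace ℝ (Fin d) → ℝ, Measurable f ∧
    μ = volume.withDensity (fun u => ENNReal.ofReal (f u)) ∧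
    (∀ u ∈ B.toSet, m ≤ f u ∧ f u ≤ M) ∧ (∀ u ∉ B.toSet, f u = 0)

/-! ### The Hilbert ordering rules

A parameter `t` is read through its base-`2 ^ d` digits; the `r`-th digit selects, in the Hilbert
order of the current orientation, one of the `2 ^ d` subcells of macro-level `r`, and is carried out
by `d` binary decisions. -/

/-- The index of the dyadic interval of order `L` that contains `t ∈ [0, 1]`; the last interval
contains its right endpoint `1`, i.e. `1 = 0.111…` in base two. -/
noncomputable def dyadicIndex (t : ℝ) (L : ℕ) : ℕ := min ⌊t * 2 ^ L⌋₊ (2 ^ L - 1)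

/-- The digit number `r` (counted from `0`) of `t` in base `2 ^ d`. -/
noncomputable def hilbertDigit (d : ℕ) (t : ℝ) (r : ℕ) : ℕ := dyadicIndex t (d * (r + 1)) % 2 ^ d

/-- The reflected Gray code. -/
def grayCode (w : ℕ) : ℕ := w ^^^ (w >>> 1)

/-- The bit of a `d`-bit number in position `i`, the position `0` being the most significant. -/
def bitFromTop (d w i : ℕ) : Bool := w.testBit (d - 1 - i)

/-- An orientation (a signed permutation of the axes): the logical axis `i` is the geometric axis
`axis i`, and the geometric axis `j` is traversed backwards when `flip j = true`. -/
structure HilbertFrame (d : ℕ) where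
  axis : Equiv.Perm (Fin d)
  flip : Fin d → Bool

/-- The vertex of the cell, in logical coordinates, at which the curve enters the subcell `w`. -/
def hilbertEntry (w : ℕ) : ℕ := if w = 0 then 0 else grayCode (2 * ((w - 1) / 2))

/-- The bit (counted from the least significant one) which is the direction of the curve inside
the subcell `w`, modulo `d`. -/
def hilbertDirection (w : ℕ) : ℕ :=
  if w = 0 then 0 else if w % 2 = 0 then padicValNat 2 w else padicValNat 2 (w + 1)

/-- The orientation inside the subcell number `w` of a cell with orientation `F`. In dimension two:
the subcells `0, 1, 2, 3` are LL, UL, UR, LR; LL is reflected across the main diagonal, LR across the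
anti-diagonal, and the other two keep the orientation. -/
def HilbertFrame.child {d : ℕ} (F : HilbertFrame d) (w : ℕ) : HilbertFrame d where
  axis := F.axis * (finRotate d)⁻¹ ^ (hilbertDirection w + 1)
  flip j := xor (F.flip j) (bitFromTop d (hilbertEntry w) (F.axis.symm j))

/-- The orientation after the macro-levels `0, …, r - 1` with digits `α 0, …, α (r - 1)`. -/
def hilbertFrame (d : ℕ) (α : ℕ → ℕ) : ℕ → HilbertFrame d
  | 0 => ⟨1, fun _ => false⟩
  | r + 1 => (hilbertFrame d α r).child (α r)

/-- The geometric coordinate which is cut by the split number `l` (counted from `0`) on the path with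
digits `α`, when `s l` is the scheduled logical coordinate. -/
def hilbertAxis {d : ℕ} (s : ℕ → Fin d) (α : ℕ → ℕ) (l : ℕ) : Fin d :=
  (hilbertFrame d α (l / d)).axis (s l)

/-- The child (`true` for the upper one) which the path with digits `α` enters after the split
number `l` (counted from `0`). -/
def hilbertSide {d : ℕ} (s : ℕ → Fin d) (α : ℕ → ℕ) (l : ℕ) : Bool :=
  xor (bitFromTop d (grayCode (α (l / d))) (l % d))
    ((hilbertFrame d α (l / d)).flip (hilbertAxis s α l))

/-- The path of `t`: the coordinate cut by each split, and the child which is entered. -/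
noncomputable def hilbertPath {d : ℕ} (s : ℕ → Fin d) (t : ℝ) (l : ℕ) : Fin d × Bool :=
  (hilbertAxis s (hilbertDigit d t) l, hilbertSide s (hilbertDigit d t) l)

/-- The path refines all coordinates in a balanced way: among the first `L` cuts, each coordinate
is cut at least `c * L / d` times, up to an additive constant. -/
def BalancedPath {d : ℕ} (path : ℕ → Fin d × Bool) (c : ℝ) : Prop :=
  ∃ C : ℝ, ∀ (j : Fin d) (L : ℕ),
    c * L / d - C ≤ (((Finset.range L).filter (fun l => (path l).1 = j)).card : ℝ)

/-! ### The population map -/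

/-- The conditional median of coordinate `j` of `μ` in the box. -/
noncomputable def medianCut {d : ℕ} (μ : Measure (EuclideanSpace ℝ (Fin d))) (B : Box d)
    (j : Fin d) : ℝ :=
  sInf {x : ℝ | μ B.toSet / 2 ≤ μ {u | u ∈ B.toSet ∧ u j ≤ x}}

/-- The nested cells along a path, with cuts at the conditional medians. -/
noncomputable def popCell {d : ℕ} (μ : Measure (EuclideanSpace ℝ (Fin d))) (B : Box d)
    (path : ℕ → Fin d × Bool) : ℕ → Box d
  | 0 => B
  | l + 1 =>
    (popCell μ B path l).cut (path l).1 (medianCut μ (popCell μ B path l) (path l).1) (path l).2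

/-- The most recent cut value of every coordinate after `L` splits (`0` for a coordinate which has
not been cut yet). -/
noncomputable def popCuts {d : ℕ} (μ : Measure (EuclideanSpace ℝ (Fin d))) (B : Box d)
    (path : ℕ → Fin d × Bool) : ℕ → Fin d → ℝ
  | 0 => fun _ => 0
  | l + 1 =>
    Function.update (popCuts μ B path l) (path l).1 (medianCut μ (popCell μ B path l) (path l).1)

/-- The finite-depth map `H_{μ,L}(t)`. -/
noncomputable def himapFinite {d : ℕ} (μ : Measure (EuclideanSpace ℝ (Fin d))) (B : Box d)
    (s : ℕ → Fin d) (t : ℝ) (L : ℕ) : EuclideanSpace ℝ (Fin d) :=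
  WithLp.toLp 2 (popCuts μ B (hilbertPath s t) L)

/-- The quantile function `Q_μ(t) = lim_{L → ∞} H_{μ,L}(t)`. -/
noncomputable def himapQuantile {d : ℕ} (μ : Measure (EuclideanSpace ℝ (Fin d))) (B : Box d)
    (s : ℕ → Fin d) (t : ℝ) : EuclideanSpace ℝ (Fin d) :=
  limUnder atTop (himapFinite μ B s t)

/-! ### The empirical tree -/

/-- The empirical median of coordinate `j` of the sample points with indices in `I`: the least `x`
such that at least half of these points have coordinate at most `x`. -/
noncomputable def empiricalMedian {d n : ℕ} (x : Fin n → EuclideanSpace ℝ (Fin d))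
    (I : Finset (Fin n)) (j : Fin d) : ℝ :=
  sInf {q : ℝ | (I.card : ℝ) / 2 ≤ ((I.filter (fun i => x i j ≤ q)).card : ℝ)}

/-- What is known at a node of the tree when the tree is traversed along a path: the sample
indices of the node, the most recent cut value of every coordinate (`0` if there is none), and
whether the construction has already stopped. -/
structure TreeState (d n : ℕ) where
  indices : Finset (Fin n)
  cuts : Fin d → ℝ
  stopped : Prop

open scoped Classical in
/-- One split along coordinate `j` at the empirical median, followed by the step into the lower
(`upper = false`) or upper child. The cut is stored; if a child is empty, no further split is made. -/
noncomputable def TreeState.next {d n : ℕ} (x : Fin n → EuclideanSpace ℝ (Fin d))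
    (S : TreeState d n) (j : Fin d) (upper : Bool) : TreeState d n :=
  let q := empiricalMedian x S.indices j
  let lower := S.indices.filter (fun i => x i j ≤ q)
  let rest := S.indices \ lower
  if S.stopped then S
  else
    { indices := if upper then rest else lower
      cuts := Function.update S.cuts j q
      stopped := lower = ∅ ∨ rest = ∅ }

/-- The state after `L` splits along a path, starting from all sample points. -/
noncomputable def treeState {d n : ℕ} (x : Fin n → EuclideanSpace ℝ (Fin d))
    (path : ℕ → Fin d × Bool) : ℕ → TreeState d n
  | 0 => ⟨Finset.univ, fun _ => 0, False⟩
  | l + 1 => (treeState x path l).next x (path l).1 (path l).2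

/-- The depth-`L` tree estimator of `Q_μ(t)` computed from the sample `x`. -/
noncomputable def himapEstimator {d n : ℕ} (x : Fin n → EuclideanSpace ℝ (Fin d))
    (s : ℕ → Fin d) (t : ℝ) (L : ℕ) : EuclideanSpace ℝ (Fin d) :=
  WithLp.toLp 2 (treeState x (hilbertPath s t) L).cuts

/-! ### Stochastic order -/

/-- `X n = O_p(r n)` as `n → ∞`. -/
def IsBigOp {Ω : Type*} [MeasurableSpace Ω] (P : Measure Ω) (X : ℕ → Ω → ℝ) (r : ℕ → ℝ) : Prop :=
  ∀ ε : ℝ, 0 < ε → ∃ K : ℝ, ∀ᶠ n in atTop, P {ω | K * r n < |X n ω|} ≤ ENNReal.ofReal ε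

/-! ### Boxes and the mass of slabs -/

/-! The argument separates a deterministic stability statement from one probabilistic estimate, and
the Hilbert path enters the rate only through its balance.

Population side: a median cut leaves at least the fraction `m / (2 * M)` of the width on either
side, because each side carries half of the mass and mass and volume are comparable. So a cell of
depth `l` has mass `2 ^ (-l)`, and its width in coordinate `j` shrinks by `ρ = 1 - m / (2 * M)` at
each cut of `j` (`popCell_spec`). Balance forces the widths to zero, so the cuts converge to a point
lying in every cell (`tendsto_himapFinite`).

Stability: suppose that the empirical measure of every half-open box is within `D` of its mass.
Along the path, the box of the tree node and the population cell then differ by mass at most `3 ^ l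
* D`. Relative to the cell mass `2 ^ (-l)` this is `6 ^ l * D`, so the faces move by `O(6 ^ l * D)`
and no node becomes empty while `6 ^ l * D` is small (`TracksCell.succ`). All later cuts stay inside
the box of the node, even where the tree no longer resembles the population cells. Hence the error
at any greater depth is at most the cell width at depth `l` plus `O(6 ^ l * D)`
(`abs_treeState_cuts_sub_le`).

Probability: a crude polynomial rate for `D` suffices, since it only influences `γ₀`. Boxes are
bracketed by unions of cells of a grid with `N` cells per axis, and Chebyshev with a union bound
gives `D = O(1 / N)` with `N ≈ n ^ α`, `α = 1 / (2 * (2 * d + 2))` (`measure_not_discrepancyLE_le`).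

Rate: comparison is made at depth about `min κ a * log n`, where `6 ^ (κ * log n) = n ^ (α / 2)`.
The sampling error is `O(n ^ (-α / 2))`, which the cell width, `n` to the power `-(c / d) * min κ a
* log (1 / ρ)`, dominates. Writing this exponent as `-c / (2 * d * γ)` gives `γ` and `γ₀ = 1 / (2 *
κ * log (1 / ρ))`. -/

theorem Box.measurableSet_toSet {d : ℕ} (A : Box d) : MeasurableSet A.toSet := by
  have : A.toSet = ⋂ j, {u : EuclideanSpace ℝ (Fin d) | A.lo j ≤ u j ∧ u j ≤ A.hi j} := by
    ext u; simp [Box.toSet]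
  rw [this]
  refine MeasurableSet.iInter fun j => ?_
  have hj : Measurable fun u : EuclideanSpace ℝ (Fin d) => u j := by fun_prop
  exact (measurableSet_le measurable_const hj).inter (measurableSet_le hj measurable_const)

theorem Box.volume_toSet {d : ℕ} (A : Box d) :
    volume A.toSet = ∏ j, ENNReal.ofReal (A.hi j - A.lo j) := by
  have h := (EuclideanSpace.volume_preserving_symm_measurableEquiv_toLp (Fin d)).symm
  have : A.toSet = (MeasurableEquiv.toLp 2 (Fin d → ℝ)).symm ⁻¹' (Set.Icc A.lo A.hi) := by
    ext u
    simp [Box.toSet, Pi.le_def, forall_and]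
  rw [this, ← Real.volume_Icc_pi]
  exact (EuclideanSpace.volume_preserving_symm_measurableEquiv_toLp (Fin d)).measure_preimage
    measurableSet_Icc.nullMeasurableSet

theorem Box.volume_toSet_ne_top {d : ℕ} (A : Box d) : volume A.toSet ≠ ⊤ := by
  rw [A.volume_toSet]
  exact ENNReal.prod_ne_top fun _ _ => ENNReal.ofReal_ne_top

theorem Box.volume_real_toSet {d : ℕ} (A : Box d) (h : ∀ j, A.lo j ≤ A.hi j) :
    volume.real A.toSet = ∏ j, (A.hi j - A.lo j) := by
  rw [Measure.real, A.volume_toSet, ENNReal.toReal_prod]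
  exact Finset.prod_congr rfl fun j _ => ENNReal.toReal_ofReal (sub_nonneg.2 (h j))

/-- Restrict coordinate `j` of a box to `[x, y]`. -/
def Box.slab {d : ℕ} (A : Box d) (j : Fin d) (x y : ℝ) : Box d :=
  ⟨Function.update A.lo j x, Function.update A.hi j y⟩

theorem Box.volume_real_slab {d : ℕ} (A : Box d) (h : ∀ j, A.lo j < A.hi j) (j : Fin d) {x y : ℝ}
    (hxy : x ≤ y) :
    volume.real (A.slab j x y).toSet = (y - x) / (A.hi j - A.lo j) * volume.real A.toSet := by
  have hne : A.hi j - A.lo j ≠ 0 := (sub_pos.2 (h j)).ne'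
  rw [Box.volume_real_toSet _ (fun k => (h k).le), Box.volume_real_toSet,
    ← Finset.mul_prod_erase _ _ (Finset.mem_univ j), ← Finset.mul_prod_erase _ (fun k => A.hi k - A.lo k) (Finset.mem_univ j)]
  · rw [← mul_assoc, div_mul_cancel₀ _ hne]
    congr 1
    · simp [Box.slab]
    · refine Finset.prod_congr rfl fun k hk => ?_
      have : k ≠ j := (Finset.mem_erase.1 hk).1
      simp [Box.slab, this]
  · intro k
    rcases eq_or_ne k j with rfl | hk
    · simpa [Box.slab] using hxy
    · simpa [Box.slab, hk] using (h k).le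

theorem Box.mem_slab {d : ℕ} (A : Box d) (j : Fin d) {x y : ℝ} (hx : A.lo j ≤ x) (hy : y ≤ A.hi j)
    (u : EuclideanSpace ℝ (Fin d)) :
    u ∈ (A.slab j x y).toSet ↔ u ∈ A.toSet ∧ x ≤ u j ∧ u j ≤ y := by
  constructor
  · intro h
    have hj := h j
    simp only [Box.slab, Function.update_self] at hj
    refine ⟨fun k => ?_, hj⟩
    rcases eq_or_ne k j with rfl | hk
    · exact ⟨hx.trans hj.1, hj.2.trans hy⟩
    · simpa [Box.slab, hk] using h k
  · rintro ⟨h, hj⟩ k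
    rcases eq_or_ne k j with rfl | hk
    · simpa [Box.slab] using hj
    · simpa [Box.slab, hk] using h k

/-! ### Consequences of the density bounds. -/

theorem HasDensityBounds.le_measure {d : ℕ} {μ : Measure (EuclideanSpace ℝ (Fin d))} {B : Box d}
    {m M : ℝ} (h : HasDensityBounds μ B m M) {S : Set (EuclideanSpace ℝ (Fin d))}
    (hS : MeasurableSet S) (hSB : S ⊆ B.toSet) : ENNReal.ofReal m * volume S ≤ μ S := by
  obtain ⟨f, hf, rfl, hb, -⟩ := h
  rw [withDensity_apply _ hS, ← setLIntegral_const]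
  exact setLIntegral_mono' hS fun u hu => ENNReal.ofReal_le_ofReal (hb u (hSB hu)).1

theorem HasDensityBounds.measure_le {d : ℕ} {μ : Measure (EuclideanSpace ℝ (Fin d))} {B : Box d}
    {m M : ℝ} (h : HasDensityBounds μ B m M) {S : Set (EuclideanSpace ℝ (Fin d))}
    (hS : MeasurableSet S) (hSB : S ⊆ B.toSet) : μ S ≤ ENNReal.ofReal M * volume S := by
  obtain ⟨f, hf, rfl, hb, -⟩ := h
  rw [withDensity_apply _ hS, ← setLIntegral_const]
  exact setLIntegral_mono' hS fun u hu => ENNReal.ofReal_le_ofReal (hb u (hSB hu)).2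

theorem HasDensityBounds.absolutelyContinuous {d : ℕ} {μ : Measure (EuclideanSpace ℝ (Fin d))}
    {B : Box d} {m M : ℝ} (h : HasDensityBounds μ B m M) : μ ≪ volume := by
  obtain ⟨f, hf, rfl, -, -⟩ := h
  exact withDensity_absolutelyContinuous _ _

theorem HasDensityBounds.measure_compl {d : ℕ} {μ : Measure (EuclideanSpace ℝ (Fin d))} {B : Box d}
    {m M : ℝ} (h : HasDensityBounds μ B m M) : μ B.toSetᶜ = 0 := by
  obtain ⟨f, hf, rfl, -, h0⟩ := h
  rw [withDensity_apply _ B.measurableSet_toSet.compl,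
    setLIntegral_congr_fun B.measurableSet_toSet.compl (g := fun _ => 0)]
  · simp
  · intro u hu
    simp [h0 u hu]

theorem HasDensityBounds.measure_hyperplane {d : ℕ} {μ : Measure (EuclideanSpace ℝ (Fin d))}
    {B : Box d} {m M : ℝ} (h : HasDensityBounds μ B m M) (j : Fin d) (x : ℝ) :
    μ {u | u j = x} = 0 := by
  have hsub : {u : EuclideanSpace ℝ (Fin d) | u j = x} ⊆ B.toSetᶜ ∪ (B.slab j x x).toSet := by
    intro u hu
    by_cases huB : u ∈ B.toSet
    · right
      intro k
      rcases eq_or_ne k j with rfl | hk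
      · simp [Box.slab, show u k = x from hu]
      · simpa [Box.slab, hk] using huB k
    · exact Or.inl huB
  refine measure_mono_null hsub (measure_union_null h.measure_compl (h.absolutelyContinuous ?_))
  rw [Box.volume_toSet, Finset.prod_eq_zero (Finset.mem_univ j)]
  simp [Box.slab]

theorem HasDensityBounds.lo_lt_hi {d : ℕ} {μ : Measure (EuclideanSpace ℝ (Fin d))}
    [IsProbabilityMeasure μ] {B : Box d} {m M : ℝ} (h : HasDensityBounds μ B m M) (j : Fin d) :
    B.lo j < B.hi j := by
  by_contra hlt
  have h0 : μ B.toSet = 0 := by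
    apply h.absolutelyContinuous
    rw [Box.volume_toSet, Finset.prod_eq_zero (Finset.mem_univ j)]
    simpa using not_lt.1 hlt
  have : μ Set.univ = 0 := by
    rw [← Set.union_compl_self B.toSet]
    exact measure_union_null h0 h.measure_compl
  simp at this

section Slab

variable {d : ℕ} {μ : Measure (EuclideanSpace ℝ (Fin d))} [IsProbabilityMeasure μ] {B : Box d}
  {m M : ℝ}

theorem HasDensityBounds.real_bounds (h : HasDensityBounds μ B m M) (hm : 0 < m) (hmM : m ≤ M)
    {A : Box d} (hA : A.toSet ⊆ B.toSet) :
    m * volume.real A.toSet ≤ μ.real A.toSet ∧ μ.real A.toSet ≤ M * volume.real A.toSet := by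
  have h1 := h.le_measure A.measurableSet_toSet hA
  have h2 := h.measure_le A.measurableSet_toSet hA
  have hv := A.volume_toSet_ne_top
  constructor
  · have := ENNReal.toReal_mono (measure_ne_top _ _) h1
    rwa [ENNReal.toReal_mul, ENNReal.toReal_ofReal hm.le] at this
  · have := ENNReal.toReal_mono (ENNReal.mul_ne_top ENNReal.ofReal_ne_top hv) h2
    rwa [ENNReal.toReal_mul, ENNReal.toReal_ofReal (hm.le.trans hmM)] at this

theorem measurableSet_coord_le (j : Fin d) (x : ℝ) :
    MeasurableSet {u : EuclideanSpace ℝ (Fin d) | u j ≤ x} :=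
  measurableSet_le (by fun_prop) measurable_const

/-- The closed slab and the difference of the two lower parts disagree only on the null hyperplane
`u j = x`. -/
theorem HasDensityBounds.real_slab (h : HasDensityBounds μ B m M) (A : Box d) (j : Fin d)
    {x y : ℝ} (hx : A.lo j ≤ x) (hxy : x ≤ y) (hy : y ≤ A.hi j) :
    μ.real (A.slab j x y).toSet =
      μ.real (A.toSet ∩ {u | u j ≤ y}) - μ.real (A.toSet ∩ {u | u j ≤ x}) := by
  have hsub : A.toSet ∩ {u | u j ≤ x} ⊆ A.toSet ∩ {u | u j ≤ y} :=
    fun u hu => ⟨hu.1, le_trans hu.2 hxy⟩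
  rw [← measureReal_sdiff hsub (A.measurableSet_toSet.inter (measurableSet_coord_le j x))]
  refine measureReal_congr ?_
  have hae : ∀ᵐ u ∂μ, u j ≠ x := by
    rw [ae_iff]; simpa using h.measure_hyperplane j x
  filter_upwards [hae] with u hu
  refine propext ?_
  change u ∈ (A.slab j x y).toSet ↔
    u ∈ (A.toSet ∩ {u | u j ≤ y}) \ (A.toSet ∩ {u | u j ≤ x})
  rw [A.mem_slab j hx hy]
  simp only [Set.mem_sdiff, Set.mem_inter_iff, Set.mem_ofPred_eq, not_and, not_le]
  constructor
  · rintro ⟨h1, h2, h3⟩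
    exact ⟨⟨h1, h3⟩, fun _ => lt_of_le_of_ne h2 (Ne.symm hu)⟩
  · rintro ⟨⟨h1, h3⟩, h2⟩
    exact ⟨h1, (h2 h1).le, h3⟩

/-- A slab takes the fraction `(y - x) / (A.hi j - A.lo j)` of the volume, and mass and volume are
comparable; so relative mass and relative width agree up to the factor `M / m`. This converts mass
errors into position errors and back. -/
theorem HasDensityBounds.slab_bounds (h : HasDensityBounds μ B m M) (hm : 0 < m) (hmM : m ≤ M)
    {A : Box d} (hA : A.toSet ⊆ B.toSet) (hlt : ∀ j, A.lo j < A.hi j) (j : Fin d) {x y : ℝ}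
    (hx : A.lo j ≤ x) (hxy : x ≤ y) (hy : y ≤ A.hi j) :
    m * μ.real A.toSet * (y - x) ≤ M * (A.hi j - A.lo j) *
        (μ.real (A.toSet ∩ {u | u j ≤ y}) - μ.real (A.toSet ∩ {u | u j ≤ x})) ∧
      m * (A.hi j - A.lo j) *
        (μ.real (A.toSet ∩ {u | u j ≤ y}) - μ.real (A.toSet ∩ {u | u j ≤ x})) ≤
      M * μ.real A.toSet * (y - x) := by
  rw [← h.real_slab A j hx hxy hy]
  have hw : 0 < A.hi j - A.lo j := sub_pos.2 (hlt j)
  have hs : (A.slab j x y).toSet ⊆ B.toSet := fun u hu => hA ((A.mem_slab j hx hy u).1 hu).1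
  obtain ⟨a1, a2⟩ := h.real_bounds hm hmM hs
  obtain ⟨b1, b2⟩ := h.real_bounds hm hmM hA
  have hv := A.volume_real_slab hlt j hxy
  have hv' : (A.hi j - A.lo j) * volume.real (A.slab j x y).toSet
      = (y - x) * volume.real A.toSet := by rw [hv]; field_simp
  have hM : 0 < M := hm.trans_le hmM
  have hyx : 0 ≤ y - x := sub_nonneg.2 hxy
  constructor
  · calc m * μ.real A.toSet * (y - x) ≤ m * (M * volume.real A.toSet) * (y - x) := by gcongr
      _ = M * (A.hi j - A.lo j) * (m * volume.real (A.slab j x y).toSet) := by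
        linear_combination (-(m * M)) * hv'
      _ ≤ _ := by gcongr
  · calc m * (A.hi j - A.lo j) * μ.real (A.slab j x y).toSet
        ≤ m * (A.hi j - A.lo j) * (M * volume.real (A.slab j x y).toSet) := by gcongr
      _ = M * (m * volume.real A.toSet) * (y - x) := by linear_combination (m * M) * hv'
      _ ≤ _ := by gcongr

theorem HasDensityBounds.real_toSet (h : HasDensityBounds μ B m M) : μ.real B.toSet = 1 := by
  have := (prob_compl_eq_zero_iff B.measurableSet_toSet).1 h.measure_compl
  simp [Measure.real, this]

/-- The mass of a slab is at most proportional to its width. -/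
theorem HasDensityBounds.real_strip_le (h : HasDensityBounds μ B m M) (hm : 0 < m) (hmM : m ≤ M)
    (j : Fin d) {x y : ℝ} (hxy : x ≤ y) :
    μ.real {u | x < u j ∧ u j ≤ y} ≤ M / (m * (B.hi j - B.lo j)) * (y - x) := by
  have hw : 0 < B.hi j - B.lo j := sub_pos.2 (h.lo_lt_hi j)
  have hM : 0 < M := hm.trans_le hmM
  have hlh := (h.lo_lt_hi j).le
  -- Clamping to the side of `B` is monotone and 1-Lipschitz, and it loses only points outside the
  -- support.
  set x' := max (B.lo j) (min x (B.hi j))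
  set y' := max (B.lo j) (min y (B.hi j))
  have hx'y' : x' ≤ y' := max_le_max le_rfl (min_le_min hxy le_rfl)
  have hy' : y' ≤ B.hi j := max_le hlh (min_le_right _ _)
  have hx' : B.lo j ≤ x' := le_max_left _ _
  have hd : y' - x' ≤ y - x := by
    simp only [x', y', max_def, min_def]
    split_ifs <;> linarith
  have hle : μ.real {u | x < u j ∧ u j ≤ y} ≤ μ.real (B.slab j x' y').toSet := by
    have : μ.real {u | x < u j ∧ u j ≤ y} ≤ μ.real (B.toSetᶜ ∪ (B.slab j x' y').toSet) := by
      refine measureReal_mono ?_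
      intro u hu
      by_cases huB : u ∈ B.toSet
      · right
        rw [B.mem_slab j hx' hy']
        have := huB j
        refine ⟨huB, max_le this.1 ((min_le_left _ _).trans hu.1.le), le_max_of_le_right (le_min hu.2 this.2)⟩
      · exact Or.inl huB
    refine this.trans ((measureReal_union_le _ _).trans ?_)
    simp [Measure.real, h.measure_compl]
  have hb := (h.slab_bounds hm hmM subset_rfl h.lo_lt_hi j hx' hx'y' hy').2
  rw [← h.real_slab B j hx' hx'y' hy', h.real_toSet, mul_one] at hb
  rw [div_mul_eq_mul_div, le_div_iff₀ (by positivity)]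
  calc μ.real {u | x < u j ∧ u j ≤ y} * (m * (B.hi j - B.lo j))
      ≤ μ.real (B.slab j x' y').toSet * (m * (B.hi j - B.lo j)) := by gcongr
    _ = m * (B.hi j - B.lo j) * μ.real (B.slab j x' y').toSet := by ring
    _ ≤ M * (y' - x') := hb
    _ ≤ _ := by gcongr

/-- The distribution function of a coordinate on any measurable set is continuous. -/
theorem HasDensityBounds.continuous_real_inter (h : HasDensityBounds μ B m M) (hm : 0 < m)
    (hmM : m ≤ M) (S : Set (EuclideanSpace ℝ (Fin d))) (j : Fin d) :
    Continuous fun x : ℝ => μ.real (S ∩ {u | u j ≤ x}) := by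
  have hw : 0 < B.hi j - B.lo j := sub_pos.2 (h.lo_lt_hi j)
  have hM : 0 < M := hm.trans_le hmM
  refine (LipschitzWith.of_le_add_mul
    (Real.toNNReal (M / (m * (B.hi j - B.lo j)))) fun x y => ?_).continuous
  rw [Real.coe_toNNReal _ (by positivity), Real.dist_eq]
  rcases le_total x y with hxy | hxy
  · have : μ.real (S ∩ {u | u j ≤ x}) ≤ μ.real (S ∩ {u | u j ≤ y}) :=
      measureReal_mono fun u hu => ⟨hu.1, le_trans hu.2 hxy⟩
    have h2 : 0 ≤ M / (m * (B.hi j - B.lo j)) * |x - y| := by positivity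
    linarith
  · rw [abs_of_nonneg (sub_nonneg.2 hxy)]
    refine le_trans (measureReal_mono (s₂ := (S ∩ {u | u j ≤ y}) ∪ {u | y < u j ∧ u j ≤ x}) ?_)
      ((measureReal_union_le _ _).trans (add_le_add le_rfl (h.real_strip_le hm hmM j hxy)))
    intro u hu
    rcases le_or_gt (u j) y with h1 | h1
    · exact Or.inl ⟨hu.1, h1⟩
    · exact Or.inr ⟨h1, hu.2⟩

end Slab

/-! ### Population cells -/

section Population

variable {d : ℕ} {μ : Measure (EuclideanSpace ℝ (Fin d))} [IsProbabilityMeasure μ] {B : Box d}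
  {m M : ℝ}

theorem Box.mem_cut (A : Box d) (j : Fin d) {q : ℝ} (h1 : A.lo j ≤ q) (h2 : q ≤ A.hi j)
    (b : Bool) (u : EuclideanSpace ℝ (Fin d)) :
    u ∈ (A.cut j q b).toSet ↔ u ∈ A.toSet ∧ (if b then q ≤ u j else u j ≤ q) := by
  cases b
  · have : A.cut j q false = A.slab j (A.lo j) q := by simp [Box.cut, Box.slab]
    rw [this, A.mem_slab j le_rfl h2]
    simp only [Bool.false_eq_true, if_false]
    exact ⟨fun h => ⟨h.1, h.2.2⟩, fun h => ⟨h.1, (h.1 j).1, h.2⟩⟩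
  · have : A.cut j q true = A.slab j q (A.hi j) := by simp [Box.cut, Box.slab]
    rw [this, A.mem_slab j h1 le_rfl]
    simp only [if_true]
    exact ⟨fun h => ⟨h.1, h.2.1⟩, fun h => ⟨h.1, h.2, (h.1 j).2⟩⟩

theorem Box.cut_of_ne (A : Box d) {j k : Fin d} (hk : k ≠ j) (q : ℝ) (b : Bool) :
    (A.cut j q b).lo k = A.lo k ∧ (A.cut j q b).hi k = A.hi k := by
  cases b <;> simp [Box.cut, hk]

theorem Box.cut_self (A : Box d) (j : Fin d) (q : ℝ) (b : Bool) :
    (A.cut j q b).lo j = (if b then q else A.lo j) ∧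
      (A.cut j q b).hi j = (if b then A.hi j else q) := by
  cases b <;> simp [Box.cut]

/-- The distribution function is continuous: closedness of the superlevel set puts the infimum in
it, and the limit from the left shows that the mass does not exceed one half. No mass lies below
`A.lo j` and all of it below `A.hi j`, which locates the cut. -/
theorem medianCut_mem_and_half (h : HasDensityBounds μ B m M) (hm : 0 < m) (hmM : m ≤ M)
    {A : Box d} (hpos : 0 < μ.real A.toSet) (j : Fin d) :
    A.lo j ≤ medianCut μ A j ∧ medianCut μ A j ≤ A.hi j ∧
      μ.real (A.toSet ∩ {u | u j ≤ medianCut μ A j}) = μ.real A.toSet / 2 := by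
  set F : ℝ → ℝ := fun x => μ.real (A.toSet ∩ {u | u j ≤ x}) with hF
  have hcont : Continuous F := h.continuous_real_inter hm hmM A.toSet j
  have hset : {x : ℝ | μ A.toSet / 2 ≤ μ {u | u ∈ A.toSet ∧ u j ≤ x}} =
      {x | μ.real A.toSet / 2 ≤ F x} := by
    ext x
    have h2 : (μ A.toSet / 2).toReal = μ.real A.toSet / 2 := by simp [Measure.real]
    rw [Set.mem_ofPred_eq, Set.mem_ofPred_eq, ← h2]
    exact (ENNReal.toReal_le_toReal (ENNReal.div_ne_top (measure_ne_top _ _) (by simp))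
      (measure_ne_top _ _)).symm
  have hlow : ∀ x ∈ {x | μ.real A.toSet / 2 ≤ F x}, A.lo j ≤ x := by
    intro x hx
    by_contra hlt
    have : F x = 0 := by
      have : A.toSet ∩ {u | u j ≤ x} = ∅ := by
        ext u
        simp only [Set.mem_inter_iff, Set.mem_ofPred_eq, Set.mem_empty_iff_false, iff_false, not_and]
        intro hu hux
        exact hlt ((hu j).1.trans hux)
      simp [hF, this]
    rw [Set.mem_ofPred_eq, this] at hx
    linarith
  have hhi : A.hi j ∈ {x | μ.real A.toSet / 2 ≤ F x} := by
    have : A.toSet ∩ {u | u j ≤ A.hi j} = A.toSet :=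
      Set.inter_eq_left.2 fun u hu => (hu j).2
    simp only [hF, Set.mem_ofPred_eq, this]
    linarith
  have hbdd : BddBelow {x | μ.real A.toSet / 2 ≤ F x} := ⟨_, hlow⟩
  have hq : medianCut μ A j = sInf {x | μ.real A.toSet / 2 ≤ F x} := by
    rw [← hset]; rfl
  have hmem : medianCut μ A j ∈ {x | μ.real A.toSet / 2 ≤ F x} := by
    rw [hq]
    exact (isClosed_le continuous_const hcont).csInf_mem ⟨_, hhi⟩ hbdd
  refine ⟨hlow _ hmem, hq ▸ csInf_le hbdd hhi, le_antisymm ?_ hmem⟩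
  refine le_of_tendsto (hcont.continuousWithinAt (s := Set.Iio (medianCut μ A j))) ?_
  filter_upwards [self_mem_nhdsWithin] with x hx
  by_contra hlt
  exact absurd (hq ▸ csInf_le hbdd (show x ∈ {x | μ.real A.toSet / 2 ≤ F x} from (not_le.1 hlt).le))
    (not_le.2 hx)

/-- The conditional median stays away from the faces of the box. -/
theorem medianCut_margins (h : HasDensityBounds μ B m M) (hm : 0 < m) (hmM : m ≤ M)
    {A : Box d} (hA : A.toSet ⊆ B.toSet) (hlt : ∀ j, A.lo j < A.hi j)
    (hpos : 0 < μ.real A.toSet) (j : Fin d) :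
    m / (2 * M) * (A.hi j - A.lo j) ≤ medianCut μ A j - A.lo j ∧
      m / (2 * M) * (A.hi j - A.lo j) ≤ A.hi j - medianCut μ A j := by
  obtain ⟨h1, h2, h3⟩ := medianCut_mem_and_half h hm hmM hpos j
  have hM : 0 < M := hm.trans_le hmM
  -- Each side is a slab with half of the mass, so the upper bound for the mass of a slab bounds its
  -- width from below; this is the origin of `m / (2 * M)`.
  have hlo := (h.slab_bounds hm hmM hA hlt j le_rfl h1 h2).2
  have hhi := (h.slab_bounds hm hmM hA hlt j h1 h2 le_rfl).2
  have e1 : μ.real (A.toSet ∩ {u | u j ≤ A.lo j}) = 0 := by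
    refine measureReal_mono_null (s₂ := {u | u j = A.lo j}) ?_ ?_
    · exact fun u hu => le_antisymm hu.2 (hu.1 j).1
    · simp [Measure.real, h.measure_hyperplane]
  have e2 : A.toSet ∩ {u | u j ≤ A.hi j} = A.toSet := Set.inter_eq_left.2 fun u hu => (hu j).2
  rw [h3, e1] at hlo
  rw [h3, e2] at hhi
  constructor
  · rw [div_mul_eq_mul_div, div_le_iff₀ (by positivity)]
    nlinarith
  · rw [div_mul_eq_mul_div, div_le_iff₀ (by positivity)]
    nlinarith

/-- The number of cuts of coordinate `j` among the first `L` splits. -/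
def cutCount (path : ℕ → Fin d × Bool) (j : Fin d) (L : ℕ) : ℕ :=
  ((Finset.range L).filter fun l => (path l).1 = j).card

theorem cutCount_succ (path : ℕ → Fin d × Bool) (j : Fin d) (L : ℕ) :
    cutCount path j (L + 1) = cutCount path j L + if (path L).1 = j then 1 else 0 := by
  unfold cutCount
  rw [Finset.range_add_one, Finset.filter_insert]
  split_ifs
  · rw [Finset.card_insert_of_notMem (by simp)]
  · simp

/-- An induction in which the margins of the median serve twice: they keep the child nondegenerate,
and removing at least `m / (2 * M)` of the width gives the geometric decay in the coordinate that is
cut. -/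
theorem popCell_spec (h : HasDensityBounds μ B m M) (hm : 0 < m) (hmM : m ≤ M)
    (path : ℕ → Fin d × Bool) (l : ℕ) :
    (popCell μ B path l).toSet ⊆ B.toSet ∧
      (∀ j, (popCell μ B path l).lo j < (popCell μ B path l).hi j) ∧
      μ.real (popCell μ B path l).toSet = (1 / 2) ^ l ∧
      ∀ j, (popCell μ B path l).hi j - (popCell μ B path l).lo j ≤
        (B.hi j - B.lo j) * (1 - m / (2 * M)) ^ cutCount path j l := by
  have hM : 0 < M := hm.trans_le hmM
  induction l with
  | zero => exact ⟨subset_rfl, h.lo_lt_hi, by simp [popCell, h.real_toSet],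
      fun j => by simp [popCell, cutCount]⟩
  | succ l ih =>
    obtain ⟨i1, i2, i3, i4⟩ := ih
    set A := popCell μ B path l with hAdef
    set j := (path l).1 with hj
    have hpos : 0 < μ.real A.toSet := by rw [i3]; positivity
    obtain ⟨h1, h2, h3⟩ := medianCut_mem_and_half h hm hmM hpos j
    obtain ⟨g1, g2⟩ := medianCut_margins h hm hmM i1 i2 hpos j
    have hr : 0 < m / (2 * M) * (A.hi j - A.lo j) :=
      mul_pos (by positivity) (sub_pos.2 (i2 j))
    have hcell : popCell μ B path (l + 1) = A.cut j (medianCut μ A j) (path l).2 := rfl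
    rw [hcell]
    have hsub : (A.cut j (medianCut μ A j) (path l).2).toSet ⊆ A.toSet :=
      fun u hu => ((A.mem_cut j h1 h2 _ u).1 hu).1
    refine ⟨hsub.trans i1, fun k => ?_, ?_, fun k => ?_⟩
    · rcases eq_or_ne k j with rfl | hk
      · rw [(A.cut_self _ _ _).1, (A.cut_self _ _ _).2]
        split_ifs <;> linarith
      · rw [(A.cut_of_ne hk _ _).1, (A.cut_of_ne hk _ _).2]
        exact i2 k
    · rw [pow_succ, ← i3]
      cases (path l).2
      · have : (A.cut j (medianCut μ A j) false).toSet =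
            A.toSet ∩ {u | u j ≤ medianCut μ A j} := by
          ext u; rw [A.mem_cut j h1 h2]; simp
        rw [this, h3]; ring
      · have e := h.real_slab A j h1 h2 le_rfl
        have e2 : A.toSet ∩ {u | u j ≤ A.hi j} = A.toSet :=
          Set.inter_eq_left.2 fun u hu => (hu j).2
        have e3 : A.cut j (medianCut μ A j) true = A.slab j (medianCut μ A j) (A.hi j) := by
          simp [Box.cut, Box.slab]
        rw [e3, e, e2, h3]; ring
    · rw [cutCount_succ]
      rcases eq_or_ne k j with rfl | hk
      · rw [(A.cut_self _ _ _).1, (A.cut_self _ _ _).2, if_pos rfl, pow_succ, ← mul_assoc]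
        have hρ : 0 ≤ 1 - m / (2 * M) := by
          rw [sub_nonneg, div_le_one (by positivity)]; linarith
        refine le_trans ?_ (mul_le_mul_of_nonneg_right (i4 _) hρ)
        split_ifs <;> linarith
      · rw [(A.cut_of_ne hk _ _).1, (A.cut_of_ne hk _ _).2, if_neg (Ne.symm hk), add_zero]
        exact i4 k

theorem popCell_succ_face (h : HasDensityBounds μ B m M) (hm : 0 < m) (hmM : m ≤ M)
    (path : ℕ → Fin d × Bool) (l : ℕ) (j : Fin d) :
    (popCell μ B path l).lo j ≤ (popCell μ B path (l + 1)).lo j ∧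
      (popCell μ B path (l + 1)).hi j ≤ (popCell μ B path l).hi j := by
  obtain ⟨i1, i2, i3, i4⟩ := popCell_spec h hm hmM path l
  set A := popCell μ B path l with hAdef
  have hpos : 0 < μ.real A.toSet := by rw [i3]; positivity
  have hcell : popCell μ B path (l + 1) = A.cut (path l).1 (medianCut μ A (path l).1) (path l).2 :=
    rfl
  rw [hcell]
  rcases eq_or_ne j (path l).1 with rfl | hk
  · obtain ⟨h1, h2, -⟩ := medianCut_mem_and_half h hm hmM hpos (path l).1
    rw [(A.cut_self _ _ _).1, (A.cut_self _ _ _).2]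
    split_ifs <;> constructor <;> linarith
  · rw [(A.cut_of_ne hk _ _).1, (A.cut_of_ne hk _ _).2]
    exact ⟨le_rfl, le_rfl⟩

/-- A new cut becomes a face of the child, and that coordinate is untouched until its next cut. One
earlier cut is required, to exclude the default value `0`. -/
theorem popCuts_mem (h : HasDensityBounds μ B m M) (hm : 0 < m) (hmM : m ≤ M)
    (path : ℕ → Fin d × Bool) (l : ℕ) (j : Fin d) (hc : 0 < cutCount path j l) :
    popCuts μ B path l j ∈ Set.Icc ((popCell μ B path l).lo j) ((popCell μ B path l).hi j) := by
  induction l with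
  | zero => simp [cutCount] at hc
  | succ l ih =>
    obtain ⟨i1, i2, i3, i4⟩ := popCell_spec h hm hmM path l
    set A := popCell μ B path l with hAdef
    have hpos : 0 < μ.real A.toSet := by rw [i3]; positivity
    have hcell : popCell μ B path (l + 1) =
      A.cut (path l).1 (medianCut μ A (path l).1) (path l).2 := rfl
    rw [hcell, popCuts]
    rcases eq_or_ne j (path l).1 with rfl | hk
    · obtain ⟨h1, h2, -⟩ := medianCut_mem_and_half h hm hmM hpos (path l).1
      rw [(A.cut_self _ _ _).1, (A.cut_self _ _ _).2, Function.update_self]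
      split_ifs
      · exact ⟨le_rfl, h2⟩
      · exact ⟨h1, le_rfl⟩
    · rw [(A.cut_of_ne hk _ _).1, (A.cut_of_ne hk _ _).2, Function.update_of_ne hk]
      rw [cutCount_succ, if_neg (Ne.symm hk), add_zero] at hc
      exact ih hc

theorem one_sub_div_mem (hm : 0 < m) (hmM : m ≤ M) :
    1 / 2 ≤ 1 - m / (2 * M) ∧ 1 - m / (2 * M) < 1 := by
  have hM : 0 < M := hm.trans_le hmM
  have h1 : 0 < m / (2 * M) := by positivity
  have h2 : m / (2 * M) ≤ 1 / 2 := by rw [div_le_div_iff₀ (by positivity) (by norm_num)]; linarith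
  constructor <;> linarith

theorem BalancedPath.tendsto_cutCount {path : ℕ → Fin d × Bool} {c : ℝ} (hp : BalancedPath path c)
    (hc : 0 < c) (j : Fin d) : Tendsto (cutCount path j) atTop atTop := by
  obtain ⟨C, hC⟩ := hp
  have hd : (0 : ℝ) < d := by exact_mod_cast j.pos
  rw [← tendsto_natCast_atTop_iff (R := ℝ)]
  refine tendsto_atTop_mono (fun L => hC j L) ?_
  refine tendsto_atTop_add_const_right _ _ ?_
  simp_rw [mul_div_right_comm]
  exact tendsto_natCast_atTop_atTop.const_mul_atTop (by positivity)

/-- The cuts of a coordinate converge to a point which lies in all cells. -/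
theorem exists_tendsto_popCuts (h : HasDensityBounds μ B m M) (hm : 0 < m) (hmM : m ≤ M)
    {path : ℕ → Fin d × Bool} {c : ℝ} (hp : BalancedPath path c) (hc : 0 < c) (j : Fin d) :
    ∃ x, Tendsto (fun l => popCuts μ B path l j) atTop (𝓝 x) ∧
      ∀ L, x ∈ Set.Icc ((popCell μ B path L).lo j) ((popCell μ B path L).hi j) := by
  have hlo : Monotone fun l => (popCell μ B path l).lo j :=
    monotone_nat_of_le_succ fun l => (popCell_succ_face h hm hmM path l j).1
  have hhi : Antitone fun l => (popCell μ B path l).hi j :=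
    antitone_nat_of_succ_le fun l => (popCell_succ_face h hm hmM path l j).2
  have hcount := hp.tendsto_cutCount hc j
  obtain ⟨hρ1, hρ2⟩ := one_sub_div_mem hm hmM
  have hw : Tendsto (fun l => (popCell μ B path l).hi j - (popCell μ B path l).lo j) atTop (𝓝 0) := by
    refine squeeze_zero (fun l => (sub_pos.2 ((popCell_spec h hm hmM path l).2.1 j)).le)
      (fun l => (popCell_spec h hm hmM path l).2.2.2 j) ?_
    have := ((tendsto_pow_atTop_nhds_zero_of_lt_one (by linarith) hρ2).comp hcount).const_mul
      (B.hi j - B.lo j)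
    simpa using this
  obtain ⟨x, hx⟩ : ∃ x, Tendsto (fun l => (popCell μ B path l).lo j) atTop (𝓝 x) := by
    refine ⟨_, tendsto_atTop_ciSup hlo ⟨B.hi j, ?_⟩⟩
    rintro _ ⟨l, rfl⟩
    exact ((popCell_spec h hm hmM path l).2.1 j).le.trans (hhi (Nat.zero_le l))
  have hx' : Tendsto (fun l => (popCell μ B path l).hi j) atTop (𝓝 x) := by
    simpa using hx.add hw
  refine ⟨x, ?_, fun L => ⟨hlo.ge_of_tendsto hx L, hhi.le_of_tendsto hx' L⟩⟩
  have hev : ∀ᶠ l in atTop, 0 < cutCount path j l := hcount.eventually_gt_atTop 0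
  refine tendsto_of_tendsto_of_tendsto_of_le_of_le' hx hx' ?_ ?_
  · filter_upwards [hev] with l hl using (popCuts_mem h hm hmM path l j hl).1
  · filter_upwards [hev] with l hl using (popCuts_mem h hm hmM path l j hl).2

/-- `himapQuantile` is a `limUnder`, hence meaningful only once convergence is known. The location
of the limit in every cell is what the comparison with the tree uses. -/
theorem tendsto_himapFinite (h : HasDensityBounds μ B m M) (hm : 0 < m) (hmM : m ≤ M)
    {s : ℕ → Fin d} {t c : ℝ} (hp : BalancedPath (hilbertPath s t) c) (hc : 0 < c) :
    Tendsto (himapFinite μ B s t) atTop (𝓝 (himapQuantile μ B s t)) ∧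
      ∀ j L, himapQuantile μ B s t j ∈ Set.Icc ((popCell μ B (hilbertPath s t) L).lo j)
        ((popCell μ B (hilbertPath s t) L).hi j) := by
  choose x hx hxL using fun j => exists_tendsto_popCuts h hm hmM hp hc j
  have ht : Tendsto (himapFinite μ B s t) atTop (𝓝 (WithLp.toLp 2 x)) :=
    ((PiLp.continuous_toLp 2 (fun _ : Fin d => ℝ)).tendsto x).comp (tendsto_pi_nhds.2 hx)
  have hq : himapQuantile μ B s t = WithLp.toLp 2 x := ht.limUnder_eq
  rw [hq]
  exact ⟨ht, fun j L => hxL j L⟩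

end Population

/-! ### The empirical tree follows the population cells -/

section Empirical

open scoped Classical symmDiff

variable {d n : ℕ} {μ : Measure (EuclideanSpace ℝ (Fin d))} {B : Box d}
  {m M : ℝ} {x : Fin n → EuclideanSpace ℝ (Fin d)}

/-- The half-open box `∏ j, (lo j, hi j]`. -/
def Box.halfOpen (A : Box d) : Set (EuclideanSpace ℝ (Fin d)) :=
  {u | ∀ j, A.lo j < u j ∧ u j ≤ A.hi j}

/-- The indices of the sample points in the half-open box. -/
noncomputable def Box.sample (A : Box d) (x : Fin n → EuclideanSpace ℝ (Fin d)) :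
    Finset (Fin n) :=
  Finset.univ.filter fun i => x i ∈ A.halfOpen

/-- The empirical measure of every half-open box is within `D` of its mass. -/
def DiscrepancyLE (μ : Measure (EuclideanSpace ℝ (Fin d))) (x : Fin n → EuclideanSpace ℝ (Fin d))
    (D : ℝ) : Prop :=
  ∀ A : Box d, |((A.sample x).card : ℝ) / n - μ.real A.halfOpen| ≤ D

theorem Box.measurableSet_halfOpen (A : Box d) : MeasurableSet A.halfOpen := by
  have : A.halfOpen = ⋂ j, {u : EuclideanSpace ℝ (Fin d) | A.lo j < u j ∧ u j ≤ A.hi j} := by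
    ext u; simp [Box.halfOpen]
  rw [this]
  refine MeasurableSet.iInter fun j => ?_
  have hj : Measurable fun u : EuclideanSpace ℝ (Fin d) => u j := by fun_prop
  exact (measurableSet_lt measurable_const hj).inter (measurableSet_le hj measurable_const)

theorem Box.halfOpen_subset (A : Box d) : A.halfOpen ⊆ A.toSet :=
  fun _ hu j => ⟨(hu j).1.le, (hu j).2⟩

theorem Box.mem_halfOpen_cut (A : Box d) (j : Fin d) {q : ℝ} (h1 : A.lo j ≤ q) (h2 : q ≤ A.hi j)
    (b : Bool) (u : EuclideanSpace ℝ (Fin d)) :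
    u ∈ (A.cut j q b).halfOpen ↔ u ∈ A.halfOpen ∧ (if b then q < u j else u j ≤ q) := by
  constructor
  · intro hu
    refine ⟨fun k => ?_, ?_⟩
    · have := hu k
      rcases eq_or_ne k j with rfl | hk
      · rw [(A.cut_self _ _ _).1, (A.cut_self _ _ _).2] at this
        cases b
        · exact ⟨this.1, this.2.trans h2⟩
        · exact ⟨h1.trans_lt this.1, this.2⟩
      · rwa [(A.cut_of_ne hk _ _).1, (A.cut_of_ne hk _ _).2] at this
    · have := hu j
      rw [(A.cut_self _ _ _).1, (A.cut_self _ _ _).2] at this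
      cases b
      · simpa using this.2
      · simpa using this.1
  · rintro ⟨hu, hb⟩ k
    rcases eq_or_ne k j with rfl | hk
    · rw [(A.cut_self _ _ _).1, (A.cut_self _ _ _).2]
      cases b
      · exact ⟨(hu k).1, by simpa using hb⟩
      · exact ⟨by simpa using hb, (hu k).2⟩
    · rw [(A.cut_of_ne hk _ _).1, (A.cut_of_ne hk _ _).2]
      exact hu k

theorem Box.mem_sample (A : Box d) (i : Fin n) : i ∈ A.sample x ↔ x i ∈ A.halfOpen := by
  simp [Box.sample]

theorem empiricalMedian_mem {I : Finset (Fin n)} (hI : I.Nonempty) (j : Fin d) {a b : ℝ}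
    (h : ∀ i ∈ I, x i j ∈ Set.Icc a b) : empiricalMedian x I j ∈ Set.Icc a b := by
  have hcard : (0 : ℝ) < I.card := by exact_mod_cast hI.card_pos
  have hb : b ∈ {q : ℝ | (I.card : ℝ) / 2 ≤ ((I.filter (fun i => x i j ≤ q)).card : ℝ)} := by
    rw [Set.mem_ofPred_eq, Finset.filter_true_of_mem fun i hi => (h i hi).2]
    linarith
  have hlow : ∀ q ∈ {q : ℝ | (I.card : ℝ) / 2 ≤ ((I.filter (fun i => x i j ≤ q)).card : ℝ)},
      a ≤ q := by
    intro q hq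
    by_contra hlt
    rw [Set.mem_ofPred_eq, Finset.filter_false_of_mem
      fun i hi hiq => hlt ((h i hi).1.trans hiq)] at hq
    simp only [Finset.card_empty, Nat.cast_zero] at hq
    linarith
  exact ⟨le_csInf ⟨b, hb⟩ hlow, csInf_le ⟨a, hlow⟩ hb⟩

/-- Counts in the lower part of a half-open box. -/
theorem DiscrepancyLE.filter_le {D : ℝ} (hD : DiscrepancyLE μ x D) (A : Box d) (j : Fin d)
    (y : ℝ) :
    |(((A.sample x).filter fun i => x i j ≤ y).card : ℝ) / n -
      μ.real (A.halfOpen ∩ {u | u j ≤ y})| ≤ D := by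
  have key : ∀ u : EuclideanSpace ℝ (Fin d),
      u ∈ (⟨A.lo, Function.update A.hi j (min y (A.hi j))⟩ : Box d).halfOpen ↔
        u ∈ A.halfOpen ∧ u j ≤ y := by
    intro u
    constructor
    · intro hu
      have hj := hu j
      simp only [Function.update_self, le_min_iff] at hj
      refine ⟨fun k => ?_, hj.2.1⟩
      rcases eq_or_ne k j with rfl | hk
      · exact ⟨hj.1, hj.2.2⟩
      · simpa [hk] using hu k
    · rintro ⟨hu, hy⟩ k
      rcases eq_or_ne k j with rfl | hk
      · simpa using ⟨(hu k).1, hy, (hu k).2⟩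
      · simpa [hk] using hu k
  have h := hD ⟨A.lo, Function.update A.hi j (min y (A.hi j))⟩
  have e1 : (⟨A.lo, Function.update A.hi j (min y (A.hi j))⟩ : Box d).sample x =
      (A.sample x).filter fun i => x i j ≤ y := by
    ext i
    rw [Box.mem_sample, key, Finset.mem_filter, Box.mem_sample]
  have e2 : (⟨A.lo, Function.update A.hi j (min y (A.hi j))⟩ : Box d).halfOpen =
      A.halfOpen ∩ {u | u j ≤ y} := Set.ext key
  rwa [e1, e2] at h

/-- The empirical median nearly halves the mass of the box. -/
theorem DiscrepancyLE.median_balance [IsProbabilityMeasure μ] (h : HasDensityBounds μ B m M)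
    (hm : 0 < m) (hmM : m ≤ M) {D : ℝ} (hD : DiscrepancyLE μ x D) (hn : 0 < n) (A : Box d)
    (hne : (A.sample x).Nonempty) (j : Fin d) :
    |μ.real (A.halfOpen ∩ {u | u j ≤ empiricalMedian x (A.sample x) j}) - μ.real A.halfOpen / 2| ≤
      3 / 2 * D := by
  set I := A.sample x with hI
  set q := empiricalMedian x I j with hq
  have hcont := h.continuous_real_inter hm hmM A.halfOpen j
  have hn' : (0 : ℝ) < n := by exact_mod_cast hn
  have hA := abs_le.1 (hD A)
  set S := {q : ℝ | (I.card : ℝ) / 2 ≤ ((I.filter (fun i => x i j ≤ q)).card : ℝ)} with hS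
  have hqS : q = sInf S := rfl
  have hcard : (0 : ℝ) < I.card := by exact_mod_cast hne.card_pos
  have hlow : ∀ y ∈ S, A.lo j ≤ y := by
    intro y hy
    by_contra hlt
    rw [hS, Set.mem_ofPred_eq, Finset.filter_false_of_mem] at hy
    · simp only [Finset.card_empty, Nat.cast_zero] at hy
      linarith
    · intro i hi hiy
      exact hlt ((((A.mem_sample i).1 hi) j).1.le.trans hiy)
  have hSne : S.Nonempty := by
    refine ⟨A.hi j, ?_⟩
    rw [hS, Set.mem_ofPred_eq, Finset.filter_true_of_mem]
    · linarith
    · exact fun i hi => (((A.mem_sample i).1 hi) j).2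
  -- Left of `q` fewer than half of the points are counted. The discrepancy costs `D` for the lower
  -- part and `D / 2` for half of the box; continuity passes to `q`. The lower bound approaches `q`
  -- from the right.
  have up : μ.real (A.halfOpen ∩ {u | u j ≤ q}) ≤ μ.real A.halfOpen / 2 + 3 / 2 * D := by
    refine le_of_tendsto (hcont.continuousWithinAt (s := Set.Iio q) (x := q)) ?_
    filter_upwards [self_mem_nhdsWithin] with y hy
    have hyS : y ∉ S := fun hyS => not_lt.2 (csInf_le ⟨_, hlow⟩ hyS) (hqS ▸ hy)
    have hlt : ((I.filter (fun i => x i j ≤ y)).card : ℝ) < I.card / 2 := not_le.1 hyS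
    have h1 := abs_le.1 (hD.filter_le A j y)
    have h2 : ((I.filter (fun i => x i j ≤ y)).card : ℝ) / n ≤ (I.card : ℝ) / n / 2 := by
      rw [div_right_comm]; gcongr
    linarith [h1.1, hA.2]
  have low : μ.real A.halfOpen / 2 - 3 / 2 * D ≤ μ.real (A.halfOpen ∩ {u | u j ≤ q}) := by
    refine ge_of_tendsto (hcont.continuousWithinAt (s := Set.Ioi q) (x := q)) ?_
    filter_upwards [self_mem_nhdsWithin] with y hy
    obtain ⟨z, hz, hzy⟩ := exists_lt_of_csInf_lt hSne (hqS ▸ hy : sInf S < y)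
    have hle : (I.card : ℝ) / 2 ≤ ((I.filter (fun i => x i j ≤ y)).card : ℝ) := by
      refine le_trans hz ?_
      exact_mod_cast Finset.card_le_card
        (Finset.monotone_filter_right _ fun i _ hi => le_trans hi hzy.le)
    have h1 := abs_le.1 (hD.filter_le A j y)
    have h2 : (I.card : ℝ) / n / 2 ≤ ((I.filter (fun i => x i j ≤ y)).card : ℝ) / n := by
      rw [div_right_comm]; gcongr
    linarith [h1.2, hA.1]
  rw [abs_le]
  constructor <;> linarith

/-! ### Stability of masses and cuts under small symmetric differences. -/

theorem abs_real_inter_sub_le [IsFiniteMeasure μ] {A H : Set (EuclideanSpace ℝ (Fin d))}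
    (S : Set (EuclideanSpace ℝ (Fin d))) :
    |μ.real (A ∩ S) - μ.real (H ∩ S)| ≤ μ.real (A ∆ H) := by
  have key : ∀ A H : Set (EuclideanSpace ℝ (Fin d)),
      μ.real (A ∩ S) ≤ μ.real (H ∩ S) + μ.real (A ∆ H) := by
    intro A H
    refine le_trans (measureReal_mono (s₂ := (H ∩ S) ∪ A ∆ H) ?_) (measureReal_union_le _ _)
    intro u hu
    by_cases hH : u ∈ H
    · exact Or.inl ⟨hH, hu.2⟩
    · exact Or.inr (Or.inl ⟨hu.1, hH⟩)
  have h1 := key A H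
  have h2 := key H A
  rw [symmDiff_comm] at h2
  rw [abs_le]
  constructor <;> linarith

theorem real_symmDiff_lower [IsFiniteMeasure μ] (A : Set (EuclideanSpace ℝ (Fin d)))
    (hA : MeasurableSet A) (j : Fin d) (y z : ℝ) :
    μ.real ((A ∩ {u | u j ≤ y}) ∆ (A ∩ {u | u j ≤ z})) =
      |μ.real (A ∩ {u | u j ≤ y}) - μ.real (A ∩ {u | u j ≤ z})| := by
  have key : ∀ y z : ℝ, y ≤ z → μ.real ((A ∩ {u | u j ≤ y}) ∆ (A ∩ {u | u j ≤ z})) =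
      |μ.real (A ∩ {u | u j ≤ y}) - μ.real (A ∩ {u | u j ≤ z})| := by
    intro y z hyz
    have hsub : A ∩ {u | u j ≤ y} ⊆ A ∩ {u | u j ≤ z} := fun u hu => ⟨hu.1, le_trans hu.2 hyz⟩
    rw [symmDiff_of_le (show (A ∩ {u | u j ≤ y}) ≤ (A ∩ {u | u j ≤ z}) from hsub),
      measureReal_sdiff hsub (hA.inter (measurableSet_coord_le j y)), abs_sub_comm, abs_of_nonneg]
    exact sub_nonneg.2 (measureReal_mono hsub)
  rcases le_total y z with h | h
  · exact key y z h
  · rw [symmDiff_comm, abs_sub_comm]; exact key z y h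

theorem HasDensityBounds.real_symmDiff_halfOpen (h : HasDensityBounds μ B m M) :
    μ.real (B.toSet ∆ B.halfOpen) = 0 := by
  have hsub : B.toSet ∆ B.halfOpen ⊆ ⋃ j, {u | u j = B.lo j} := by
    rintro u (⟨hu, hu'⟩ | ⟨hu, hu'⟩)
    · simp only [Box.halfOpen, Set.mem_ofPred_eq, not_forall] at hu'
      obtain ⟨j, hj⟩ := hu'
      refine Set.mem_iUnion.2 ⟨j, ?_⟩
      by_contra hne
      exact hj ⟨lt_of_le_of_ne (hu j).1 (Ne.symm hne), (hu j).2⟩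
    · exact absurd (B.halfOpen_subset hu) hu'
  have h0 : μ (B.toSet ∆ B.halfOpen) = 0 :=
    measure_mono_null hsub (measure_iUnion_null fun j => h.measure_hyperplane j _)
  simp [Measure.real, h0]

/-- Cutting two sets at different values. -/
theorem HasDensityBounds.real_symmDiff_cut [IsProbabilityMeasure μ] (h : HasDensityBounds μ B m M)
    {A E : Box d} (j : Fin d) {q r : ℝ} (hq : q ∈ Set.Icc (A.lo j) (A.hi j))
    (hr : r ∈ Set.Icc (E.lo j) (E.hi j)) (b : Bool) :
    μ.real ((A.cut j q b).toSet ∆ (E.cut j r b).halfOpen) ≤ μ.real (A.toSet ∆ E.halfOpen) +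
      |μ.real (A.toSet ∩ {u | u j ≤ q}) - μ.real (A.toSet ∩ {u | u j ≤ r})| := by
  rw [← real_symmDiff_lower _ A.measurableSet_toSet]
  refine le_trans ?_ (measureReal_union_le _ _)
  have hle : μ.real ((A.cut j q b).toSet ∆ (E.cut j r b).halfOpen) ≤
      μ.real ({u | u j = q} ∪ (A.toSet ∆ E.halfOpen ∪
        (A.toSet ∩ {u | u j ≤ q}) ∆ (A.toSet ∩ {u | u j ≤ r}))) := by
    refine measureReal_mono ?_
    intro u hu
    -- The closed upper child contains its face `u j = q`, the half-open one does not; off this null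
    -- set both children are given by `u j ≤ q` or its negation, and the comparison passes through
    -- `A` cut at `r`.
    by_cases huq : u j = q
    · exact Or.inl huq
    right
    rw [Set.mem_symmDiff, A.mem_cut j hq.1 hq.2, E.mem_halfOpen_cut j hr.1 hr.2] at hu
    simp only [Set.mem_union, Set.mem_symmDiff, Set.mem_inter_iff, Set.mem_ofPred_eq]
    have hne : q ≤ u j ↔ ¬ u j ≤ q :=
      ⟨fun h1 h2 => huq (le_antisymm h2 h1), fun h1 => (not_le.1 h1).le⟩
    cases b
    · simp only [Bool.false_eq_true, if_false] at hu
      have aux : ∀ a b c e : Prop, (a ∧ c) ∧ ¬(b ∧ e) ∨ (b ∧ e) ∧ ¬(a ∧ c) →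
        (a ∧ ¬b ∨ b ∧ ¬a) ∨ ((a ∧ c) ∧ ¬(a ∧ e) ∨ (a ∧ e) ∧ ¬(a ∧ c)) := by tauto
      exact aux _ _ _ _ hu
    · simp only [if_true, hne, ← not_le] at hu
      have aux : ∀ a b c e : Prop, (a ∧ ¬c) ∧ ¬(b ∧ ¬e) ∨ (b ∧ ¬e) ∧ ¬(a ∧ ¬c) →
        (a ∧ ¬b ∨ b ∧ ¬a) ∨ ((a ∧ c) ∧ ¬(a ∧ e) ∨ (a ∧ e) ∧ ¬(a ∧ c)) := by tauto
      exact aux _ _ _ _ hu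
  refine hle.trans ((measureReal_union_le _ _).trans ?_)
  simp [Measure.real, h.measure_hyperplane]

/-! ### Coupling of the tree nodes with the population cells. -/

/-- The half-open boxes which contain the sample points of the nodes along a path. -/
noncomputable def empBox (x : Fin n → EuclideanSpace ℝ (Fin d)) (B : Box d)
    (path : ℕ → Fin d × Bool) : ℕ → Box d
  | 0 => B
  | l + 1 => (empBox x B path l).cut (path l).1
      (empiricalMedian x ((empBox x B path l).sample x) (path l).1) (path l).2

/-- Comparison of the node of the tree at depth `l` with the population cell. -/
structure TracksCell (μ : Measure (EuclideanSpace ℝ (Fin d))) (B : Box d)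
    (x : Fin n → EuclideanSpace ℝ (Fin d)) (path : ℕ → Fin d × Bool) (D e : ℝ) (l : ℕ) :
    Prop where
  not_stopped : ¬ (treeState x path l).stopped
  indices_eq : (treeState x path l).indices = (empBox x B path l).sample x
  symmDiff_le : μ.real ((popCell μ B path l).toSet ∆ (empBox x B path l).halfOpen) + D ≤ 3 ^ l * D
  lo_near : ∀ j, |(empBox x B path l).lo j - (popCell μ B path l).lo j| ≤ e
  hi_near : ∀ j, |(empBox x B path l).hi j - (popCell μ B path l).hi j| ≤ e
  cuts_mem : ∀ j, 0 < cutCount path j l → (treeState x path l).cuts j ∈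
    Set.Icc ((empBox x B path l).lo j) ((empBox x B path l).hi j)

/-- The smallness condition says that `3 ^ l * D` is at most a tenth of the cell mass `2 ^ (-l)`, so
an empty box would contradict the discrepancy bound. -/
theorem TracksCell.sample_nonempty [IsProbabilityMeasure μ] (h : HasDensityBounds μ B m M)
    (hm : 0 < m) (hmM : m ≤ M) {D e : ℝ} (hD : DiscrepancyLE μ x D)
    {path : ℕ → Fin d × Bool} {l : ℕ} (hsmall : 10 * 6 ^ l * D ≤ 1)
    (ih : TracksCell μ B x path D e l) : ((empBox x B path l).sample x).Nonempty := by
  obtain ⟨-, -, i3, -⟩ := popCell_spec h hm hmM path l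
  rw [Finset.nonempty_iff_ne_empty]
  intro hemp
  have h1 := abs_le.1 (hD (empBox x B path l))
  rw [hemp] at h1
  simp only [Finset.card_empty, Nat.cast_zero, zero_div, zero_sub, neg_le_neg_iff] at h1
  have h2 := abs_le.1 (abs_real_inter_sub_le (μ := μ) (A := (popCell μ B path l).toSet)
    (H := (empBox x B path l).halfOpen) Set.univ)
  rw [Set.inter_univ, Set.inter_univ, i3] at h2
  have h3 := ih.symmDiff_le
  have hT : 3 ^ l * D ≤ (1 / 2) ^ l / 10 := by
    have e6 : (6 : ℝ) ^ l = 3 ^ l * 2 ^ l := by rw [← mul_pow]; norm_num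
    rw [one_div, inv_pow, le_div_iff₀ (by norm_num), ← one_div, le_div_iff₀ (by positivity)]
    rw [e6] at hsmall
    linarith
  have hp : (0 : ℝ) < (1 / 2) ^ l := by positivity
  linarith [h2.2, h1.1]

/-- With `Δ` the mass of the symmetric difference, cutting at `r` instead of `q` costs at most `3 /
2 * (Δ + D)`. Thus `Δ + D` grows at most by the factor `5 / 2`, rounded up to `3`; carrying the
summand `D` makes the recursion homogeneous. The position error is the mass error divided by the
cell mass, whence `6 = 3 * 2`. -/
theorem TracksCell.succ [IsProbabilityMeasure μ] (h : HasDensityBounds μ B m M)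
    (hm : 0 < m) (hmM : m ≤ M) {D e : ℝ} (hD : DiscrepancyLE μ x D)
    (hn : 0 < n) {path : ℕ → Fin d × Bool} {l : ℕ} (hsmall : 10 * 6 ^ l * D ≤ 1)
    (he : ∀ j, 2 * (M / m) * (B.hi j - B.lo j) * (6 ^ l * D) ≤ e)
    (ih : TracksCell μ B x path D e l) : TracksCell μ B x path D e (l + 1) := by
  have hne := ih.sample_nonempty h hm hmM hD hsmall
  obtain ⟨i1, i2, i3, i4⟩ := popCell_spec h hm hmM path l
  have hM : 0 < M := hm.trans_le hmM
  set A := popCell μ B path l with hA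
  set E := empBox x B path l with hE
  set j := (path l).1 with hj
  set r := empiricalMedian x (E.sample x) j with hr
  set q := medianCut μ A j with hq
  set p : ℝ := (1 / 2) ^ l with hp
  have hp0 : 0 < p := by positivity
  have hD0 : 0 ≤ D := (abs_nonneg _).trans (hD E)
  have hpos : 0 < μ.real A.toSet := by rw [i3]; exact hp0
  obtain ⟨hq1, hq2, hq3⟩ := medianCut_mem_and_half h hm hmM hpos j
  have e6 : (6 : ℝ) ^ l = 3 ^ l * 2 ^ l := by rw [← mul_pow]; norm_num
  have hp2 : 2 ^ l * p = 1 := by rw [hp, ← mul_pow]; norm_num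
  have hTp : 3 ^ l * D = 6 ^ l * D * p := by
    rw [e6]; linear_combination (-(3 ^ l * D)) * hp2
  have hT : 3 ^ l * D ≤ p / 10 := by
    rw [hTp]
    nlinarith
  have hΔ := ih.symmDiff_le
  have hDT : D ≤ 3 ^ l * D := le_mul_of_one_le_left hD0 (one_le_pow₀ (by norm_num))
  have hrE : r ∈ Set.Icc (E.lo j) (E.hi j) := empiricalMedian_mem hne j fun i hi =>
    ⟨(((E.mem_sample i).1 hi) j).1.le, (((E.mem_sample i).1 hi) j).2⟩
  have hbal := abs_le.1 (hD.median_balance h hm hmM hn E hne j)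
  have hAE := abs_le.1 (abs_real_inter_sub_le (μ := μ) (A := A.toSet) (H := E.halfOpen) Set.univ)
  rw [Set.inter_univ, Set.inter_univ, i3] at hAE
  have hAEr := abs_le.1 (abs_real_inter_sub_le (μ := μ) (A := A.toSet) (H := E.halfOpen)
    {u | u j ≤ r})
  rw [i3] at hq3
  -- The empirical imbalance contributes `3 / 2 * D`, replacing the box by the cell contributes `Δ`
  -- for the lower part and `Δ / 2` for half of the total.
  have hF : |μ.real (A.toSet ∩ {u | u j ≤ q}) - μ.real (A.toSet ∩ {u | u j ≤ r})| ≤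
      3 / 2 * (3 ^ l * D) := by
    rw [hq3, abs_le]
    constructor <;> linarith [hbal.1, hbal.2, hAE.1, hAE.2, hAEr.1, hAEr.2]
  have hF' := abs_le.1 hF
  -- Outside the cell the lower part would have mass `0` or `p`, off by `p / 2`, whereas the mass
  -- error is at most `3 / 20 * p`.
  have hrA : r ∈ Set.Icc (A.lo j) (A.hi j) := by
    constructor
    · by_contra hlt
      have : A.toSet ∩ {u | u j ≤ r} = ∅ := by
        ext u
        simp only [Set.mem_inter_iff, Set.mem_ofPred_eq, Set.mem_empty_iff_false, iff_false, not_and]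
        exact fun hu hur => hlt ((hu j).1.trans hur)
      rw [this, hq3, measureReal_empty] at hF'
      linarith [hF'.2]
    · by_contra hlt
      have : A.toSet ∩ {u | u j ≤ r} = A.toSet :=
        Set.inter_eq_left.2 fun u hu => (hu j).2.trans (not_le.1 hlt).le
      rw [this, hq3, i3] at hF'
      linarith [hF'.1]
  have hqr : |r - q| ≤ e := by
    have hw : A.hi j - A.lo j ≤ B.hi j - B.lo j := by
      refine (i4 j).trans ?_
      obtain ⟨hρ1, hρ2⟩ := one_sub_div_mem hm hmM
      exact mul_le_of_le_one_right (sub_pos.2 (h.lo_lt_hi j)).le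
        (pow_le_one₀ (by linarith) hρ2.le)
    have hw0 : 0 < A.hi j - A.lo j := sub_pos.2 (i2 j)
    have key : m * p * |r - q| ≤ M * (A.hi j - A.lo j) * (3 / 2 * (3 ^ l * D)) := by
      rcases le_total q r with hle | hle
      · have := (h.slab_bounds hm hmM i1 i2 j hq1 hle hrA.2).1
        rw [i3] at this
        rw [abs_of_nonneg (sub_nonneg.2 hle)]
        exact this.trans (mul_le_mul_of_nonneg_left (by linarith [hF'.1]) (by positivity))
      · have := (h.slab_bounds hm hmM i1 i2 j hrA.1 hle hq2).1
        rw [i3] at this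
        rw [abs_sub_comm, abs_of_nonneg (sub_nonneg.2 hle)]
        exact this.trans (mul_le_mul_of_nonneg_left (by linarith [hF'.2]) (by positivity))
    refine le_trans ?_ (he j)
    have h6 : 0 ≤ (6 : ℝ) ^ l * D := by positivity
    rw [hTp] at key
    have key2 : m * |r - q| ≤ M * (A.hi j - A.lo j) * (3 / 2 * (6 ^ l * D)) := by
      refine le_of_mul_le_mul_left ?_ hp0
      linarith
    have key3 : M * (A.hi j - A.lo j) * (3 / 2 * (6 ^ l * D)) ≤
        M * (B.hi j - B.lo j) * (2 * (6 ^ l * D)) := by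
      have hB0 : 0 < B.hi j - B.lo j := hw0.trans_le hw
      gcongr
      norm_num
    have : 2 * (M / m) * (B.hi j - B.lo j) * (6 ^ l * D) =
        (M * (B.hi j - B.lo j) * (2 * (6 ^ l * D))) / m := by field_simp
    rw [this, le_div_iff₀ hm]
    linarith
  have hlow := abs_le.1 (hD.filter_le E j r)
  have hEE := abs_le.1 (hD E)
  have hn' : (0 : ℝ) < n := by exact_mod_cast hn
  have hst : treeState x path (l + 1) = (treeState x path l).next x j (path l).2 := rfl
  have hcell : popCell μ B path (l + 1) = A.cut j q (path l).2 := rfl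
  have hbox : empBox x B path (l + 1) = E.cut j r (path l).2 := rfl
  have hnx : (treeState x path (l + 1)).indices = (if (path l).2 then
        E.sample x \ (E.sample x).filter (fun i => x i j ≤ r)
        else (E.sample x).filter (fun i => x i j ≤ r)) ∧
      (treeState x path (l + 1)).cuts = Function.update (treeState x path l).cuts j r ∧
      (treeState x path (l + 1)).stopped = ((E.sample x).filter (fun i => x i j ≤ r) = ∅ ∨
        E.sample x \ (E.sample x).filter (fun i => x i j ≤ r) = ∅) := by
    rw [hst]
    simp only [TreeState.next, if_neg ih.not_stopped, ih.indices_eq]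
    exact ⟨rfl, rfl, rfl⟩
  obtain ⟨hn1, hn2, hn3⟩ := hnx
  refine ⟨?_, ?_, ?_, fun k => ?_, fun k => ?_, fun k hk => ?_⟩
  -- Either part being empty would contradict the near balance of the two masses, since `D` and `Δ`
  -- are small against `p`.
  · rw [hn3]
    rintro (h0 | h0)
    · rw [h0] at hlow
      simp only [Finset.card_empty, Nat.cast_zero, zero_div] at hlow
      linarith [hlow.1, hlow.2, hbal.1, hAE.2]
    · have : E.sample x = (E.sample x).filter (fun i => x i j ≤ r) :=
        Finset.Subset.antisymm (Finset.sdiff_eq_empty_iff_subset.1 h0) (Finset.filter_subset _ _)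
      rw [← this] at hlow
      linarith [hlow.2, hEE.1, hbal.2, hAE.2]
  · rw [hn1, hbox]
    ext i
    rw [Box.mem_sample, E.mem_halfOpen_cut j hrE.1 hrE.2]
    cases (path l).2
    · simp [Box.mem_sample]
    · simp only [if_true, Finset.mem_sdiff, Finset.mem_filter, Box.mem_sample]
      constructor
      · rintro ⟨h1, h2⟩
        exact ⟨h1, not_le.1 fun h3 => h2 ⟨h1, h3⟩⟩
      · rintro ⟨h1, h2⟩
        exact ⟨h1, fun h3 => not_le.2 h2 h3.2⟩
  · rw [hcell, hbox, pow_succ]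
    have := h.real_symmDiff_cut (A := A) (E := E) j ⟨hq1, hq2⟩ hrE (path l).2
    linarith
  · rw [hcell, hbox]
    rcases eq_or_ne k j with rfl | hk
    · rw [(A.cut_self _ _ _).1, (E.cut_self _ _ _).1]
      split_ifs
      · exact hqr
      · exact ih.lo_near _
    · rw [(A.cut_of_ne hk _ _).1, (E.cut_of_ne hk _ _).1]
      exact ih.lo_near k
  · rw [hcell, hbox]
    rcases eq_or_ne k j with rfl | hk
    · rw [(A.cut_self _ _ _).2, (E.cut_self _ _ _).2]
      split_ifs
      · exact ih.hi_near _
      · exact hqr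
    · rw [(A.cut_of_ne hk _ _).2, (E.cut_of_ne hk _ _).2]
      exact ih.hi_near k
  · rw [hn2, hbox]
    rcases eq_or_ne k j with rfl | hkj
    · rw [(E.cut_self _ _ _).1, (E.cut_self _ _ _).2, Function.update_self]
      split_ifs
      · exact ⟨le_rfl, hrE.2⟩
      · exact ⟨hrE.1, le_rfl⟩
    · rw [(E.cut_of_ne hkj _ _).1, (E.cut_of_ne hkj _ _).2, Function.update_of_ne hkj]
      rw [cutCount_succ, if_neg (Ne.symm hkj), add_zero] at hk
      exact ih.cuts_mem k hk

theorem tracksCell [IsProbabilityMeasure μ] (h : HasDensityBounds μ B m M)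
    (hm : 0 < m) (hmM : m ≤ M) {D e : ℝ} (hD : DiscrepancyLE μ x D) (hx : ∀ i, x i ∈ B.halfOpen)
    (hn : 0 < n) (he0 : 0 ≤ e) {path : ℕ → Fin d × Bool} {L : ℕ} (hsmall : 10 * 6 ^ L * D ≤ 1)
    (he : ∀ j, 2 * (M / m) * (B.hi j - B.lo j) * (6 ^ L * D) ≤ e) :
    ∀ l ≤ L, TracksCell μ B x path D e l := by
  have hD0 : 0 ≤ D := (abs_nonneg _).trans (hD B)
  have hM : 0 < M := hm.trans_le hmM
  intro l
  induction l with
  | zero =>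
    intro _
    refine ⟨id, ?_, ?_, fun j => ?_, fun j => ?_, fun j hj => ?_⟩
    · ext i
      simp [treeState, empBox, Box.mem_sample, hx i]
    · simp [popCell, empBox, h.real_symmDiff_halfOpen]
    · simpa [popCell, empBox] using he0
    · simpa [popCell, empBox] using he0
    · simp [cutCount] at hj
  | succ l ih =>
    intro hl
    have hpow : (6 : ℝ) ^ l ≤ 6 ^ L := pow_le_pow_right₀ (by norm_num) (by omega)
    refine (ih (by omega)).succ h hm hmM hD hn (le_trans (by gcongr) hsmall) fun j => ?_
    refine le_trans ?_ (he j)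
    have := (sub_pos.2 (h.lo_lt_hi j)).le
    gcongr

/-- Cuts which are made later stay in the box of an earlier node. -/
theorem treeState_cuts_mem {path : ℕ → Fin d × Bool} {L : ℕ} {E : Box d}
    (h0 : (treeState x path L).indices = E.sample x) (hne : (E.sample x).Nonempty)
    {J : Set (Fin d)} (hc : ∀ j ∈ J, (treeState x path L).cuts j ∈ Set.Icc (E.lo j) (E.hi j))
    (k : ℕ) :
    (treeState x path (L + k)).indices ⊆ E.sample x ∧
      ((treeState x path (L + k)).stopped ∨ (treeState x path (L + k)).indices.Nonempty) ∧
      ∀ j ∈ J, (treeState x path (L + k)).cuts j ∈ Set.Icc (E.lo j) (E.hi j) := by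
  induction k with
  | zero => exact ⟨h0.subset, Or.inr (by rw [add_zero, h0]; exact hne), hc⟩
  | succ k ih =>
    obtain ⟨i1, i2, i3⟩ := ih
    have hst : treeState x path (L + (k + 1)) =
      (treeState x path (L + k)).next x (path (L + k)).1 (path (L + k)).2 := rfl
    rw [hst]
    set S := treeState x path (L + k)
    by_cases hs : S.stopped
    · simp only [TreeState.next, if_pos hs]
      exact ⟨i1, Or.inl hs, i3⟩
    · have hSne : S.indices.Nonempty := i2.resolve_left hs
      simp only [TreeState.next, if_neg hs]
      refine ⟨?_, ?_, fun j hj => ?_⟩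
      · split_ifs
        · exact Finset.sdiff_subset.trans i1
        · exact (Finset.filter_subset _ _).trans i1
      · rw [or_iff_not_imp_left]
        intro hno
        rw [not_or] at hno
        split_ifs
        · exact Finset.nonempty_iff_ne_empty.2 hno.2
        · exact Finset.nonempty_iff_ne_empty.2 hno.1
      · rcases eq_or_ne j (path (L + k)).1 with rfl | hne'
        · rw [Function.update_self]
          exact empiricalMedian_mem hSne _ fun i hi =>
            ⟨(((E.mem_sample i).1 (i1 hi)) _).1.le, (((E.mem_sample i).1 (i1 hi)) _).2⟩
        · rw [Function.update_of_ne hne']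
          exact i3 j hj

/-- The error of the cuts of the tree of depth at least `L` is bounded by the width of the
population cell of depth `L` and by the discrepancy. -/
theorem abs_treeState_cuts_sub_le [IsProbabilityMeasure μ] (h : HasDensityBounds μ B m M)
    (hm : 0 < m) (hmM : m ≤ M) {D e : ℝ} (hD : DiscrepancyLE μ x D) (hx : ∀ i, x i ∈ B.halfOpen)
    (hn : 0 < n) (he0 : 0 ≤ e) {path : ℕ → Fin d × Bool} {L L' : ℕ}
    (hsmall : 10 * 6 ^ L * D ≤ 1)
    (he : ∀ j, 2 * (M / m) * (B.hi j - B.lo j) * (6 ^ L * D) ≤ e) (hL : L ≤ L') (j : Fin d)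
    (hj : 0 < cutCount path j L) {z : ℝ}
    (hz : z ∈ Set.Icc ((popCell μ B path L).lo j) ((popCell μ B path L).hi j)) :
    |(treeState x path L').cuts j - z| ≤
      (B.hi j - B.lo j) * (1 - m / (2 * M)) ^ cutCount path j L + e := by
  have ht := tracksCell h hm hmM hD hx hn he0 (path := path) hsmall he L le_rfl
  have hne := ht.sample_nonempty h hm hmM hD hsmall
  obtain ⟨k, rfl⟩ := Nat.exists_eq_add_of_le hL
  have hc := (treeState_cuts_mem ht.indices_eq hne (J := {j})
    (fun i hi => by rw [Set.mem_singleton_iff.1 hi]; exact ht.cuts_mem j hj) k).2.2 j rfl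
  have hw := (popCell_spec h hm hmM path L).2.2.2 j
  have h1 := abs_le.1 (ht.lo_near j)
  have h2 := abs_le.1 (ht.hi_near j)
  rw [abs_le]
  constructor <;> linarith [hc.1, hc.2, hz.1, hz.2, h1.1, h1.2, h2.1, h2.2]

end Empirical

/-! ### Uniform deviations over boxes -/

section Deviation

open scoped Classical

variable {d : ℕ} {μ : Measure (EuclideanSpace ℝ (Fin d))} {B : Box d} {m M : ℝ}

theorem HasDensityBounds.measure_compl_halfOpen [IsProbabilityMeasure μ]
    (h : HasDensityBounds μ B m M) : μ B.halfOpenᶜ = 0 := by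
  have h0 : μ (symmDiff B.toSet B.halfOpen) = 0 := by
    exact (measureReal_eq_zero_iff (measure_ne_top _ _)).1 h.real_symmDiff_halfOpen
  refine measure_mono_null (t := B.toSetᶜ ∪ symmDiff B.toSet B.halfOpen) ?_
    (measure_union_null h.measure_compl h0)
  intro u hu
  by_cases hB : u ∈ B.toSet
  · exact Or.inr (Or.inl ⟨hB, hu⟩)
  · exact Or.inl hB

/-- The number of the grid cell of width `(hi j - lo j) / N` which contains the value `y` of
coordinate `j`, clipped to `{0, …, N + 1}`. -/
noncomputable def Box.gridIndex (B : Box d) (N : ℕ) (j : Fin d) (y : ℝ) : ℕ :=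
  min ⌈(y - B.lo j) / (B.hi j - B.lo j) * N⌉₊ (N + 1)

theorem Box.gridIndex_mono (B : Box d) (N : ℕ) (j : Fin d) (hj : B.lo j < B.hi j) :
    Monotone (B.gridIndex N j) := by
  intro y z hyz
  have : 0 < B.hi j - B.lo j := sub_pos.2 hj
  unfold Box.gridIndex
  gcongr

theorem Box.gridIndex_le (B : Box d) (N : ℕ) (j : Fin d) (y : ℝ) : B.gridIndex N j y < N + 2 :=
  Nat.lt_succ_of_le (min_le_right _ _)

/-- Up to a null set, a slice of constant index lies in a strip of width `w / N`, and a strip has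
mass at most `M / (m * w)` times its width. -/
theorem HasDensityBounds.real_gridIndex_le [IsProbabilityMeasure μ] (h : HasDensityBounds μ B m M)
    (hm : 0 < m) (hmM : m ≤ M) {N : ℕ} (hN : 0 < N) (j : Fin d) (c : ℕ) :
    μ.real {u | B.gridIndex N j (u j) = c} ≤ M / m / N := by
  have hw : 0 < B.hi j - B.lo j := sub_pos.2 (h.lo_lt_hi j)
  have hN' : (0 : ℝ) < N := by exact_mod_cast hN
  set w := B.hi j - B.lo j with hwdef
  have hsub : {u : EuclideanSpace ℝ (Fin d) | B.gridIndex N j (u j) = c} ⊆ B.halfOpenᶜ ∪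
      {u | B.lo j + (c - 1) * w / N < u j ∧ u j ≤ B.lo j + c * w / N} := by
    intro u hu
    by_cases hB : u ∈ B.halfOpen
    · right
      obtain ⟨h1, h2⟩ := hB j
      have ht : 0 < (u j - B.lo j) / w * N := by
        have := sub_pos.2 h1
        positivity
      have htN : (u j - B.lo j) / w * N ≤ N := by
        refine mul_le_of_le_one_left hN'.le ?_
        rw [div_le_one hw, hwdef]; linarith
      have hceil : ⌈(u j - B.lo j) / w * N⌉₊ = c := by
        have hu' : B.gridIndex N j (u j) = c := hu
        rw [← hu', Box.gridIndex, min_eq_left]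
        exact (Nat.ceil_le.2 htN).trans (Nat.le_succ _)
      have hc1 : (u j - B.lo j) / w * N ≤ c := hceil ▸ Nat.le_ceil _
      have hc2 : (c : ℝ) < (u j - B.lo j) / w * N + 1 := hceil ▸ Nat.ceil_lt_add_one ht.le
      have e : u j = B.lo j + (u j - B.lo j) / w * N * w / N := by field_simp; ring
      constructor
      · rw [e]; gcongr; linarith
      · rw [e]; gcongr
    · exact Or.inl hB
  refine (measureReal_mono hsub).trans ((measureReal_union_le _ _).trans ?_)
  have h0 : μ.real B.halfOpenᶜ = 0 := by simp [Measure.real, h.measure_compl_halfOpen]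
  rw [h0, zero_add]
  have hle : B.lo j + ((c : ℝ) - 1) * w / N ≤ B.lo j + c * w / N := by gcongr; linarith
  refine (h.real_strip_le hm hmM j hle).trans (le_of_eq ?_)
  rw [← hwdef]
  field_simp
  ring

/-- Unions of grid cells: `∏ j, {p j ≤ index ≤ r j}`, or with strict inequalities. -/
def Box.gridSet (B : Box d) (N : ℕ) (p r : Fin d → ℕ) (strict : Bool) :
    Set (EuclideanSpace ℝ (Fin d)) :=
  {u | ∀ j, if strict then p j < B.gridIndex N j (u j) ∧ B.gridIndex N j (u j) < r j
    else p j ≤ B.gridIndex N j (u j) ∧ B.gridIndex N j (u j) ≤ r j}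

theorem Box.measurableSet_gridSet (B : Box d) (hB : ∀ j, B.lo j < B.hi j) (N : ℕ)
    (p r : Fin d → ℕ) (b : Bool) : MeasurableSet (B.gridSet N p r b) := by
  have hj : ∀ j, Measurable fun u : EuclideanSpace ℝ (Fin d) => B.gridIndex N j (u j) := fun j =>
    (B.gridIndex_mono N j (hB j)).measurable.comp (by fun_prop)
  have : B.gridSet N p r b = ⋂ j, {u | if b then p j < B.gridIndex N j (u j) ∧
      B.gridIndex N j (u j) < r j
      else p j ≤ B.gridIndex N j (u j) ∧ B.gridIndex N j (u j) ≤ r j} := by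
    ext u; simp only [Box.gridSet, Set.mem_ofPred_eq, Set.mem_iInter]
  rw [this]
  refine MeasurableSet.iInter fun j => ?_
  cases b
  · simp only [Bool.false_eq_true, if_false]
    exact (measurableSet_le measurable_const (hj j)).inter (measurableSet_le (hj j) measurable_const)
  · simp only [if_true]
    exact (measurableSet_lt measurable_const (hj j)).inter (measurableSet_lt (hj j) measurable_const)

/-- The empirical frequency of a set. -/
noncomputable def empFreq {n : ℕ} (x : Fin n → EuclideanSpace ℝ (Fin d))
    (S : Set (EuclideanSpace ℝ (Fin d))) : ℝ :=
  ((Finset.univ.filter fun i => x i ∈ S).card : ℝ) / n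

theorem empFreq_mono {n : ℕ} (x : Fin n → EuclideanSpace ℝ (Fin d))
    {S T : Set (EuclideanSpace ℝ (Fin d))} (hST : S ⊆ T) : empFreq x S ≤ empFreq x T := by
  unfold empFreq
  gcongr

/-- Bracketing: a half-open box lies between the grid sets with strict and with weak inequalities at
the indices of its corners. They differ by at most two slices per coordinate, each of mass at most
`M / m / N`. Clipping the index leaves finitely many grid sets for arbitrary corners. -/
theorem discrepancyLE_of_grid [IsProbabilityMeasure μ] (h : HasDensityBounds μ B m M)
    (hm : 0 < m) (hmM : m ≤ M) {N n : ℕ} (hN : 0 < N) {x : Fin n → EuclideanSpace ℝ (Fin d)}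
    {τ : ℝ} (hτ : ∀ (p r : Fin d → Fin (N + 2)) (b : Bool),
      |empFreq x (B.gridSet N (fun j => p j) (fun j => r j) b) -
        μ.real (B.gridSet N (fun j => p j) (fun j => r j) b)| ≤ τ) :
    DiscrepancyLE μ x (τ + 2 * d * (M / m / N)) := by
  intro A
  change |empFreq x A.halfOpen - μ.real A.halfOpen| ≤ _
  set p : Fin d → Fin (N + 2) := fun j => ⟨B.gridIndex N j (A.lo j), B.gridIndex_le _ _ _⟩
  set r : Fin d → Fin (N + 2) := fun j => ⟨B.gridIndex N j (A.hi j), B.gridIndex_le _ _ _⟩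
  set G := fun b => B.gridSet N (fun j => p j) (fun j => r j) b with hG
  have hmono := fun j => B.gridIndex_mono N j (h.lo_lt_hi j)
  have hin : G true ⊆ A.halfOpen := by
    intro u hu j
    have := hu j
    simp only [if_true, p, r] at this
    exact ⟨(hmono j).reflect_lt this.1, ((hmono j).reflect_lt this.2).le⟩
  have hout : A.halfOpen ⊆ G false := by
    intro u hu j
    simp only [Bool.false_eq_true, if_false, p, r]
    exact ⟨hmono j (hu j).1.le, hmono j (hu j).2⟩
  have hdiff : μ.real (G false) ≤ μ.real (G true) + 2 * d * (M / m / N) := by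
    have hsub : G false ⊆ G true ∪ ⋃ j ∈ (Finset.univ : Finset (Fin d)),
        ({u | B.gridIndex N j (u j) = p j} ∪ {u | B.gridIndex N j (u j) = r j}) := by
      intro u hu
      by_cases hu' : u ∈ G true
      · exact Or.inl hu'
      right
      simp only [hG, Box.gridSet, if_true, Set.mem_ofPred_eq, not_forall] at hu'
      obtain ⟨j, hj⟩ := hu'
      have hj' := hu j
      simp only [Bool.false_eq_true, if_false] at hj'
      refine Set.mem_iUnion₂.2 ⟨j, Finset.mem_univ _, ?_⟩
      by_cases h1 : B.gridIndex N j (u j) = p j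
      · exact Or.inl h1
      · refine Or.inr ?_
        by_contra h2
        exact hj ⟨lt_of_le_of_ne hj'.1 (Ne.symm h1), lt_of_le_of_ne hj'.2 h2⟩
    refine (measureReal_mono hsub).trans ((measureReal_union_le _ _).trans ?_)
    gcongr
    refine (measureReal_biUnion_finset_le _ _).trans ?_
    refine (Finset.sum_le_sum (g := fun _ => 2 * (M / m / N)) fun j _ => ?_).trans ?_
    · have h1 := h.real_gridIndex_le hm hmM hN j (p j)
      have h2 := h.real_gridIndex_le hm hmM hN j (r j)
      refine (measureReal_union_le _ _).trans ?_
      linarith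
    · simp only [Finset.sum_const, Finset.card_univ, Fintype.card_fin, nsmul_eq_mul]
      linarith
  have a1 := abs_le.1 (hτ p r true)
  have a2 := abs_le.1 (hτ p r false)
  have b1 := empFreq_mono x hin
  have b2 := empFreq_mono x hout
  have c1 := measureReal_mono (μ := μ) hin
  have c2 := measureReal_mono (μ := μ) hout
  rw [abs_le]
  constructor <;> linarith [a1.1, a2.2]

/-! ### Probability of a large discrepancy. -/

variable {Ω : Type*} [MeasurableSpace Ω] {P : Measure Ω} [IsProbabilityMeasure P]
  {U : ℕ → Ω → EuclideanSpace ℝ (Fin d)}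

/-- Chebyshev's inequality for an empirical frequency. -/
theorem measure_empFreq_deviation_le (hU : ∀ i, Measurable (U i)) (hind : iIndepFun U P)
    (hlaw : ∀ i, P.map (U i) = μ) {G : Set (EuclideanSpace ℝ (Fin d))} (hG : MeasurableSet G)
    {n : ℕ} (hn : 0 < n) {τ : ℝ} (hτ : 0 < τ) :
    P {ω | τ < |empFreq (fun i : Fin n => U i ω) G - μ.real G|} ≤
      ENNReal.ofReal (1 / (n * τ ^ 2)) := by
  set φ : EuclideanSpace ℝ (Fin d) → ℝ := G.indicator fun _ => 1 with hφ
  have hφm : Measurable φ := measurable_const.indicator hG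
  set X : ℕ → Ω → ℝ := fun i => φ ∘ U i with hX
  have hXm : ∀ i, Measurable (X i) := fun i => hφm.comp (hU i)
  have hX01 : ∀ i ω, X i ω ∈ Set.Icc (0 : ℝ) 1 := by
    intro i ω
    simp only [hX, hφ, Function.comp, Set.indicator_apply]
    split_ifs <;> simp
  have hXLp : ∀ i, MemLp (X i) 2 P := fun i =>
    memLp_of_bounded (Eventually.of_forall fun ω => hX01 i ω) (hXm i).aestronglyMeasurable 2
  have hXE : ∀ i, ∫ ω, X i ω ∂P = μ.real G := by
    intro i
    rw [← hlaw i, map_measureReal_apply (hU i) hG, ← integral_indicator_one (hU i hG)]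
    rfl
  have hvar : variance (∑ i ∈ Finset.range n, X i) P ≤ n := by
    rw [IndepFun.variance_sum (fun i _ => hXLp i)
      fun i _ j _ hij => (hind.indepFun hij).comp hφm hφm]
    refine (Finset.sum_le_sum (g := fun _ => (1 : ℝ)) fun i _ => ?_).trans (by simp)
    refine (variance_le_sq_of_bounded (Eventually.of_forall fun ω => hX01 i ω)
      (hXm i).aemeasurable).trans (by norm_num)
  have hn' : (0 : ℝ) < n := by exact_mod_cast hn
  have hE : ∫ ω, (∑ i ∈ Finset.range n, X i) ω ∂P = n * μ.real G := by
    simp only [Finset.sum_apply]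
    rw [integral_finsetSum _ fun i _ => (hXLp i).integrable (by norm_num)]
    simp [hXE]
  have hcheb := meas_ge_le_variance_div_sq (memLp_finsetSum' (Finset.range n) fun i _ => hXLp i)
    (c := n * τ) (by positivity)
  refine le_trans (measure_mono ?_) (hcheb.trans (ENNReal.ofReal_le_ofReal ?_))
  · intro ω hω
    rw [Set.mem_ofPred_eq] at hω ⊢
    rw [hE]
    have e : empFreq (fun i : Fin n => U i ω) G = (∑ i ∈ Finset.range n, X i) ω / n := by
      rw [empFreq, Finset.sum_apply, Finset.sum_range]
      simp [hX, hφ, Set.indicator_apply]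
    rw [e] at hω
    have e2 : (∑ i ∈ Finset.range n, X i) ω - n * μ.real G =
        n * ((∑ i ∈ Finset.range n, X i) ω / n - μ.real G) := by field_simp
    rw [e2, abs_mul, abs_of_pos hn']
    gcongr
  · calc variance (∑ i ∈ Finset.range n, X i) P / (n * τ) ^ 2 ≤ n / (n * τ) ^ 2 := by gcongr
      _ = 1 / (n * τ ^ 2) := by field_simp

/-- Union bound over the `2 * (N + 2) ^ (2 * d)` grid sets, with Chebyshev at level `1 / N` costing
`N ^ 2 / n` for each. -/
theorem measure_not_discrepancyLE_le [IsProbabilityMeasure μ] (h : HasDensityBounds μ B m M)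
    (hm : 0 < m) (hmM : m ≤ M) (hU : ∀ i, Measurable (U i)) (hind : iIndepFun U P)
    (hlaw : ∀ i, P.map (U i) = μ) {n N : ℕ} (hn : 0 < n) (hN : 0 < N) :
    P {ω | ¬ DiscrepancyLE μ (fun i : Fin n => U i ω) ((1 + 2 * d * (M / m)) / N)} ≤
      ENNReal.ofReal (2 * ((N : ℝ) + 2) ^ (2 * d + 2) / n) := by
  have hN' : (0 : ℝ) < N := by exact_mod_cast hN
  have hn' : (0 : ℝ) < n := by exact_mod_cast hn
  set ι := (Fin d → Fin (N + 2)) × (Fin d → Fin (N + 2)) × Bool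
  set G : ι → Set (EuclideanSpace ℝ (Fin d)) := fun k =>
    B.gridSet N (fun j => k.1 j) (fun j => k.2.1 j) k.2.2
  have hsub : {ω | ¬ DiscrepancyLE μ (fun i : Fin n => U i ω) ((1 + 2 * d * (M / m)) / N)} ⊆
      ⋃ k : ι, {ω | 1 / (N : ℝ) < |empFreq (fun i : Fin n => U i ω) (G k) - μ.real (G k)|} := by
    intro ω hω
    by_contra hno
    rw [Set.mem_iUnion, not_exists] at hno
    apply hω
    have := discrepancyLE_of_grid h hm hmM hN (x := fun i : Fin n => U i ω) (τ := 1 / (N : ℝ))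
      fun p r b => not_lt.1 (hno (p, r, b))
    convert this using 1
    field_simp
  refine (measure_mono hsub).trans ((measure_iUnion_fintype_le _ _).trans ?_)
  refine (Finset.sum_le_sum fun k _ => measure_empFreq_deviation_le hU hind hlaw
    (B.measurableSet_gridSet h.lo_lt_hi N _ _ _) hn (by positivity : 0 < 1 / (N : ℝ))).trans ?_
  rw [Finset.sum_const, nsmul_eq_mul, ← ENNReal.ofReal_natCast, ← ENNReal.ofReal_mul (by positivity)]
  refine ENNReal.ofReal_le_ofReal ?_
  have hcard : (Finset.univ : Finset ι).card = 2 * (N + 2) ^ (2 * d) := by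
    simp [ι, Finset.card_univ, Fintype.card_prod]
    ring
  rw [hcard]
  push_cast
  have : (2 * ((N : ℝ) + 2) ^ (2 * d)) * (1 / (n * (1 / (N : ℝ)) ^ 2)) =
      2 * ((N + 2) ^ (2 * d) * (N : ℝ) ^ 2) / n := by field_simp
  rw [this, pow_add]
  gcongr
  linarith

end Deviation

/-! ### The rate of convergence -/

section Rate

variable {d : ℕ} {μ : Measure (EuclideanSpace ℝ (Fin d))} {B : Box d} {m M : ℝ}

theorem EuclideanSpace.norm_le_sqrt_mul (v : EuclideanSpace ℝ (Fin d)) {b : ℝ} (hb : 0 ≤ b)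
    (h : ∀ j, |v j| ≤ b) : ‖v‖ ≤ Real.sqrt d * b := by
  rw [EuclideanSpace.norm_eq, ← Real.sqrt_sq hb, ← Real.sqrt_mul (Nat.cast_nonneg d)]
  refine Real.sqrt_le_sqrt ?_
  calc ∑ j, ‖v j‖ ^ 2 ≤ ∑ _j : Fin d, b ^ 2 :=
        Finset.sum_le_sum fun j _ => pow_le_pow_left₀ (norm_nonneg _) (h j) 2
    _ = d * b ^ 2 := by simp

/-- The mesh of the grid which is used for `n` sample points. -/
noncomputable def gridSize (α : ℝ) (n : ℕ) : ℕ := ⌈(n : ℝ) ^ α⌉₊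

/-- At most `L` of the first `L` cuts can hit one coordinate. This bound makes the cell width
dominate the sampling error. -/
theorem BalancedPath.div_le_one {path : ℕ → Fin d × Bool} {c : ℝ} (hp : BalancedPath path c)
    (j : Fin d) : c / d ≤ 1 := by
  obtain ⟨C, hC⟩ := hp
  by_contra hlt
  obtain ⟨L, hL⟩ := exists_nat_gt (C / (c / d - 1))
  rw [div_lt_iff₀ (sub_pos.2 (not_le.1 hlt))] at hL
  have h1 := hC j L
  have h2 : (((Finset.range L).filter (fun l => (path l).1 = j)).card : ℝ) ≤ L := by
    exact_mod_cast (Finset.card_filter_le _ _).trans (Finset.card_range L).le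
  rw [mul_div_right_comm] at h1
  linarith

theorem tendsto_log_natCast : Tendsto (fun n : ℕ => Real.log n) atTop atTop :=
  Real.tendsto_log_atTop.comp tendsto_natCast_atTop_atTop

/-- Deterministic form of the rate: on the good samples, stability is applied at the truncated depth
`min (L n) ⌊κ * log n⌋₊`, where both the cell width and `6 ^ L' * D` are powers of `n`. -/
theorem exists_eventually_norm_sub_le [IsProbabilityMeasure μ] (h : HasDensityBounds μ B m M)
    (hm : 0 < m) (hmM : m ≤ M) {s : ℕ → Fin d} {t c : ℝ} (hc : 0 < c)
    (hp : BalancedPath (hilbertPath s t) c) {α κ κ' a C₀ : ℝ} (hα : 0 < α) (hκ : 0 < κ)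
    (hκα : κ * Real.log 6 = α / 2) (ha : 0 < a) (hκ' : κ' = min κ a) (hC₀ : 0 ≤ C₀) {L : ℕ → ℕ}
    (hL : ∀ᶠ n : ℕ in atTop, a * Real.log n ≤ L n) :
    ∃ K : ℝ, ∀ᶠ n : ℕ in atTop, ∀ x : Fin n → EuclideanSpace ℝ (Fin d),
      (∀ i, x i ∈ B.halfOpen) → DiscrepancyLE μ x (C₀ / gridSize α n) →
      ‖himapEstimator x s t (L n) - himapQuantile μ B s t‖ ≤
        K * (n : ℝ) ^ (-(c / d * (κ' * -Real.log (1 - m / (2 * M))))) := by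
  set ρ := 1 - m / (2 * M) with hρ
  obtain ⟨hρ1, hρ2⟩ := one_sub_div_mem hm hmM
  rw [← hρ] at hρ1 hρ2
  have hρ0 : 0 < ρ := by linarith
  set lam := -Real.log ρ with hlam
  have hlam0 : 0 < lam := neg_pos.2 (Real.log_neg hρ0 hρ2)
  have hlam2 : lam ≤ Real.log 6 := by
    have : Real.log (1 / 6) ≤ Real.log ρ := Real.log_le_log (by norm_num) (by linarith)
    rw [one_div, Real.log_inv] at this
    linarith
  have hM : 0 < M := hm.trans_le hmM
  have hd : (0 : ℝ) < d := by exact_mod_cast (s 0).pos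
  have hcd := hp.div_le_one (s 0)
  have hcd0 : 0 < c / d := by positivity
  have hκ'0 : 0 < κ' := by rw [hκ']; exact lt_min hκ ha
  have hκ'κ : κ' ≤ κ := hκ' ▸ min_le_left _ _
  have hκ'a : κ' ≤ a := hκ' ▸ min_le_right _ _
  obtain ⟨-, hQ⟩ := tendsto_himapFinite h hm hmM hp hc
  obtain ⟨C, hC⟩ := hp
  set W := ∑ j, (B.hi j - B.lo j) with hW
  have hw0 : ∀ j, 0 < B.hi j - B.lo j := fun j => sub_pos.2 (h.lo_lt_hi j)
  have hjW : ∀ j, B.hi j - B.lo j ≤ W := fun j =>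
    Finset.single_le_sum (f := fun j => B.hi j - B.lo j) (fun k _ => (hw0 k).le) (Finset.mem_univ j)
  have hW0 : 0 < W := (hw0 (s 0)).trans_le (hjW (s 0))
  set β := c / d * (κ' * lam) with hβ
  -- The width exponent does not exceed that of the sampling error, as `c / d ≤ 1`, `κ' ≤ κ` and
  -- `lam ≤ log 6`.
  have hβα : β ≤ α / 2 := by
    calc β ≤ 1 * (κ * Real.log 6) := by rw [hβ]; gcongr
      _ = α / 2 := by rw [one_mul, hκα]
  -- The exponential absorbs the loss of one level to the floor and the additive constant `C` of the
  -- balance condition.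
  refine ⟨Real.sqrt d * (W * Real.exp (lam * (c / d + C)) + 2 * (M / m) * W * C₀), ?_⟩
  have hsmallEv : ∀ᶠ n : ℕ in atTop, 10 * C₀ * (n : ℝ) ^ (-(α / 2)) ≤ 1 := by
    have ht : Tendsto (fun n : ℕ => 10 * C₀ * (n : ℝ) ^ (-(α / 2))) atTop (𝓝 (10 * C₀ * 0)) :=
      ((tendsto_rpow_neg_atTop (by positivity)).comp tendsto_natCast_atTop_atTop).const_mul _
    rw [mul_zero] at ht
    exact (ht.eventually_lt_const one_pos).mono fun _ hn => hn.le
  have hcountEv : ∀ᶠ n : ℕ in atTop, 0 < c / d * (κ' * Real.log n - 1) - C := by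
    have ht : Tendsto (fun n : ℕ => c / d * (κ' * Real.log n - 1) - C) atTop atTop :=
      tendsto_atTop_add_const_right _ _ ((tendsto_atTop_add_const_right _ _
        (tendsto_log_natCast.const_mul_atTop hκ'0)).const_mul_atTop hcd0)
    exact ht.eventually_gt_atTop 0
  filter_upwards [hL, hsmallEv, hcountEv, eventually_ge_atTop 1] with n hLn hsm hct hn1 x hx hD
  have hn' : (1 : ℝ) ≤ n := by exact_mod_cast hn1
  have hn0 : (0 : ℝ) < n := by linarith
  have hlog : 0 ≤ Real.log n := Real.log_nonneg hn'
  set L' := min (L n) ⌊κ * Real.log n⌋₊ with hL'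
  have hL'lo : κ' * Real.log n - 1 ≤ L' := by
    rw [hL', Nat.cast_min, le_min_iff]
    constructor
    · have := mul_le_mul_of_nonneg_right hκ'a hlog
      linarith
    · have h1 := mul_le_mul_of_nonneg_right hκ'κ hlog
      have h2 := Nat.lt_floor_add_one (κ * Real.log n)
      linarith
  have hL'hi : (L' : ℝ) ≤ κ * Real.log n :=
    (Nat.cast_le.2 (min_le_right _ _)).trans (Nat.floor_le (by positivity))
  have h6 : (6 : ℝ) ^ L' ≤ (n : ℝ) ^ (α / 2) := by
    rw [← Real.rpow_natCast, Real.rpow_def_of_pos (by norm_num), Real.rpow_def_of_pos hn0,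
      ← hκα]
    refine Real.exp_le_exp.2 ?_
    have := mul_le_mul_of_nonneg_left hL'hi (Real.log_nonneg (by norm_num : (1 : ℝ) ≤ 6))
    linarith
  have hDle : C₀ / gridSize α n ≤ C₀ * (n : ℝ) ^ (-α) := by
    rw [Real.rpow_neg hn0.le, ← div_eq_mul_inv]
    have : (0 : ℝ) < (n : ℝ) ^ α := by positivity
    gcongr
    exact Nat.le_ceil _
  have h6D : (6 : ℝ) ^ L' * (C₀ / gridSize α n) ≤ C₀ * (n : ℝ) ^ (-(α / 2)) := by
    calc (6 : ℝ) ^ L' * (C₀ / gridSize α n) ≤ (n : ℝ) ^ (α / 2) * (C₀ * (n : ℝ) ^ (-α)) := by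
          gcongr
      _ = C₀ * ((n : ℝ) ^ (α / 2) * (n : ℝ) ^ (-α)) := by ring
      _ = C₀ * (n : ℝ) ^ (-(α / 2)) := by
          rw [← Real.rpow_add hn0]; congr 2; ring
  have hpow : (n : ℝ) ^ (-(α / 2)) ≤ (n : ℝ) ^ (-β) :=
    Real.rpow_le_rpow_of_exponent_le hn' (by linarith)
  set e := 2 * (M / m) * W * (C₀ * (n : ℝ) ^ (-(α / 2))) with he
  have he0 : 0 ≤ e := by positivity
  have key : ∀ j, |(himapEstimator x s t (L n) - himapQuantile μ B s t) j| ≤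
      (W * Real.exp (lam * (c / d + C)) + 2 * (M / m) * W * C₀) * (n : ℝ) ^ (-β) := by
    intro j
    have hcount : c / d * (κ' * Real.log n - 1) - C ≤ cutCount (hilbertPath s t) j L' := by
      refine le_trans ?_ (hC j L')
      rw [mul_div_right_comm]
      gcongr
    have hcpos : 0 < cutCount (hilbertPath s t) j L' := by
      have := hct.trans_le hcount
      exact_mod_cast this
    have hmain := abs_treeState_cuts_sub_le h hm hmM hD hx hn1 he0 (L := L') (L' := L n)
      (by linarith) (fun j => by rw [he]; gcongr; exact hjW j) (min_le_left _ _) j hcpos (hQ j L')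
    change |(treeState x (hilbertPath s t) (L n)).cuts j - himapQuantile μ B s t j| ≤ _
    refine hmain.trans ?_
    have hρc : ρ ^ cutCount (hilbertPath s t) j L' ≤
        Real.exp (lam * (c / d + C)) * (n : ℝ) ^ (-β) := by
      rw [← Real.rpow_natCast, Real.rpow_def_of_pos hρ0, Real.rpow_def_of_pos hn0, ← Real.exp_add]
      refine Real.exp_le_exp.2 ?_
      have h1 := mul_le_mul_of_nonneg_left hcount hlam0.le
      have h2 : Real.log ρ = -lam := by rw [hlam]; ring
      rw [h2, hβ]
      linarith
    calc (B.hi j - B.lo j) * ρ ^ cutCount (hilbertPath s t) j L' + e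
        ≤ W * (Real.exp (lam * (c / d + C)) * (n : ℝ) ^ (-β)) +
          2 * (M / m) * W * (C₀ * (n : ℝ) ^ (-β)) := by
          rw [he]
          gcongr
          exact hjW j
      _ = _ := by ring
  have := EuclideanSpace.norm_le_sqrt_mul _ (by positivity) key
  linarith

theorem tendsto_grid_failure {α : ℝ} (hα : α * (2 * d + 2) = 1 / 2) :
    Tendsto (fun n : ℕ => 2 * ((gridSize α n : ℝ) + 2) ^ (2 * d + 2) / n) atTop (𝓝 0) := by
  have hα0 : 0 < α := by
    by_contra hle
    have : α * (2 * d + 2) ≤ 0 := mul_nonpos_of_nonpos_of_nonneg (not_lt.1 hle) (by positivity)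
    linarith
  have ht : Tendsto (fun n : ℕ => 2 * 4 ^ (2 * d + 2) * (n : ℝ) ^ (-(1 / 2 : ℝ))) atTop
      (𝓝 (2 * 4 ^ (2 * d + 2) * 0)) :=
    ((tendsto_rpow_neg_atTop (by norm_num)).comp tendsto_natCast_atTop_atTop).const_mul _
  rw [mul_zero] at ht
  refine squeeze_zero' (Eventually.of_forall fun n => by positivity) ?_ ht
  filter_upwards [eventually_ge_atTop 1] with n hn
  have hn' : (1 : ℝ) ≤ n := by exact_mod_cast hn
  have hn0 : (0 : ℝ) < n := by linarith
  have h1 : 1 ≤ (n : ℝ) ^ α := Real.one_le_rpow hn' hα0.le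
  -- Rounding up adds at most `1`, so the left side is at most `n ^ α + 3`, and `n ^ α ≥ 1`.
  have h2 : (gridSize α n : ℝ) + 2 ≤ 4 * (n : ℝ) ^ α := by
    have := Nat.ceil_lt_add_one (zero_le_one.trans h1)
    rw [gridSize]
    linarith
  have h3 : ((n : ℝ) ^ α) ^ (2 * d + 2) = (n : ℝ) ^ (1 / 2 : ℝ) := by
    rw [← Real.rpow_natCast, ← Real.rpow_mul hn0.le, ← hα]
    push_cast
    rfl
  have h4 : (n : ℝ) ^ (1 / 2 : ℝ) / n = (n : ℝ) ^ (-(1 / 2 : ℝ)) := by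
    rw [← Real.rpow_sub_one hn0.ne']; norm_num
  calc 2 * ((gridSize α n : ℝ) + 2) ^ (2 * d + 2) / n
      ≤ 2 * (4 * (n : ℝ) ^ α) ^ (2 * d + 2) / n := by gcongr
    _ = 2 * 4 ^ (2 * d + 2) * ((n : ℝ) ^ (1 / 2 : ℝ) / n) := by rw [mul_pow, h3]; ring
    _ = _ := by rw [h4]

/-- The exceptional event is covered by a large discrepancy, of vanishing probability, and by points
on or outside the excluded faces of `B`, of probability zero. One `K` thus works for every `ε`;
monotonicity of the outer measure avoids any measurability of the error. -/
theorem isBigOp_of_discrepancy [IsProbabilityMeasure μ] (h : HasDensityBounds μ B m M)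
    (hm : 0 < m) (hmM : m ≤ M) {α : ℝ} (hα : α * (2 * d + 2) = 1 / 2)
    {Ω : Type*} [MeasurableSpace Ω] {P : Measure Ω} [IsProbabilityMeasure P]
    {U : ℕ → Ω → EuclideanSpace ℝ (Fin d)} (hU : ∀ i, Measurable (U i)) (hind : iIndepFun U P)
    (hlaw : ∀ i, P.map (U i) = μ) {err : ∀ n, (Fin n → EuclideanSpace ℝ (Fin d)) → ℝ}
    {r : ℕ → ℝ} {K : ℝ}
    (hK : ∀ᶠ n : ℕ in atTop, ∀ x : Fin n → EuclideanSpace ℝ (Fin d), (∀ i, x i ∈ B.halfOpen) →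
      DiscrepancyLE μ x ((1 + 2 * d * (M / m)) / gridSize α n) → |err n x| ≤ K * r n) :
    IsBigOp P (fun n ω => err n fun i => U i ω) r := by
  intro ε hε
  refine ⟨K, ?_⟩
  filter_upwards [hK, (tendsto_grid_failure hα).eventually_lt_const hε, eventually_ge_atTop 1]
    with n hn hfail hn1
  have hn0 : (0 : ℝ) < n := by exact_mod_cast hn1
  have hN : 0 < gridSize α n := Nat.ceil_pos.2 (by positivity)
  have hsub : {ω | K * r n < |err n fun i => U i ω|} ⊆
      {ω | ¬ DiscrepancyLE μ (fun i : Fin n => U i ω) ((1 + 2 * d * (M / m)) / gridSize α n)} ∪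
        ⋃ i : Fin n, U i ⁻¹' B.halfOpenᶜ := by
    intro ω hω
    by_contra hno
    rw [Set.mem_union, not_or, Set.mem_iUnion, not_exists] at hno
    refine not_lt.2 (hn (fun i => U i ω) (fun i => ?_) (not_not.1 hno.1)) hω
    exact not_not.1 (hno.2 i)
  have hnull : P (⋃ i : Fin n, U i ⁻¹' B.halfOpenᶜ) = 0 := measure_iUnion_null fun i => by
    rw [← Measure.map_apply (hU i) B.measurableSet_halfOpen.compl, hlaw i]
    exact h.measure_compl_halfOpen
  refine (measure_mono hsub).trans ((measure_union_le _ _).trans ?_)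
  rw [hnull, add_zero]
  exact (measure_not_discrepancyLE_le h hm hmM hU hind hlaw hn1 hN).trans
    (ENNReal.ofReal_le_ofReal hfail.le)

end Rate

/-! ### Choice of the constants. -/

theorem theorem2 {d : ℕ} (B : Box d) (m M : ℝ) (hm : 0 < m) (hmM : m ≤ M) :
    ∃ γ₀ : ℝ, 0 < γ₀ ∧
      ∀ (μ : Measure (EuclideanSpace ℝ (Fin d))) [IsProbabilityMeasure μ],
        HasDensityBounds μ B m M →
      ∀ (s : ℕ → Fin d) (c : ℝ), 0 < c →
      ∀ t : ℝ, 0 ≤ t → t ≤ 1 → BalancedPath (hilbertPath s t) c →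
        Tendsto (himapFinite μ B s t) atTop (𝓝 (himapQuantile μ B s t)) ∧
        ∀ (a b : ℝ) (L : ℕ → ℕ), 0 < a →
          (∀ᶠ n : ℕ in atTop, a * Real.log n ≤ L n ∧ (L n : ℝ) ≤ b * Real.log n) →
        ∀ γ : ℝ, γ = max γ₀ (1 / (2 * a * Real.log (1 / (1 - m / (2 * M))))) →
        ∀ {Ω : Type*} [MeasurableSpace Ω] (P : Measure Ω) [IsProbabilityMeasure P]
          (U : ℕ → Ω → EuclideanSpace ℝ (Fin d)),
          (∀ i, Measurable (U i)) → iIndepFun U P → (∀ i, P.map (U i) = μ) →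
          IsBigOp P
            (fun n ω => ‖himapEstimator (fun i : Fin n => U i ω) s t (L n) - himapQuantile μ B s t‖)
            (fun n => (n : ℝ) ^ (-(c / (2 * d * γ)))) := by
  obtain ⟨hρ1, hρ2⟩ := one_sub_div_mem hm hmM
  set lam := Real.log (1 / (1 - m / (2 * M))) with hlam
  have hlam' : lam = -Real.log (1 - m / (2 * M)) := by rw [hlam, one_div, Real.log_inv]
  have hlam0 : 0 < lam := by rw [hlam']; exact neg_pos.2 (Real.log_neg (by linarith) hρ2)
  have hM : 0 < M := hm.trans_le hmM
  have hlog6 : 0 < Real.log 6 := Real.log_pos (by norm_num)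
  -- This makes `N ^ (2 * d + 2)` of order `n ^ (1 / 2)`, leaving failure probability `O(n ^ (-1 /
  -- 2))`; `κ` then solves `κ * log 6 = α / 2`.
  set α : ℝ := 1 / (2 * (2 * d + 2)) with hα
  set κ : ℝ := α / (2 * Real.log 6) with hκ
  have hα0 : 0 < α := by positivity
  have hκ0 : 0 < κ := by positivity
  refine ⟨1 / (2 * κ * lam), by positivity, ?_⟩
  intro μ _ h s c hc t _ _ hp
  refine ⟨(tendsto_himapFinite h hm hmM hp hc).1, ?_⟩
  intro a b L ha hL γ hγ Ω _ P _ U hU hind hlaw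
  have hd : (0 : ℝ) < d := by exact_mod_cast (s 0).pos
  -- The maximum of the two candidates for `γ` corresponds to the minimum of the depth constants `κ`
  -- and `a`.
  have hγ' : γ = 1 / (2 * min κ a * lam) := by
    rw [hγ]
    rcases le_total κ a with hle | hle
    · rw [min_eq_left hle]
      exact max_eq_left (by gcongr)
    · rw [min_eq_right hle]
      exact max_eq_right (by gcongr)
  have hmin : 0 < min κ a := lt_min hκ0 ha
  have hrate : c / (2 * d * γ) = c / d * (min κ a * -Real.log (1 - m / (2 * M))) := by
    rw [hγ', ← hlam']
    field_simp
  obtain ⟨K, hK⟩ := exists_eventually_norm_sub_le h hm hmM hc hp hα0 hκ0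
    (by rw [hκ]; field_simp) ha rfl (show 0 ≤ 1 + 2 * d * (M / m) by positivity)
    (hL.mono fun n hn => hn.1)
  rw [hrate]
  refine isBigOp_of_discrepancy h hm hmM (α := α) (by rw [hα]; field_simp) hU hind hlaw
    (err := fun n x => ‖himapEstimator x s t (L n) - himapQuantile μ B s t‖) (K := K) ?_
  filter_upwards [hK] with n hn x hx hD
  rw [abs_norm]
  exact hn x hx hD
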